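/- Let $0<a\le\infty$ and let $f$ be complex analytic in $[0,a]$ (in $[0,\infty)$ if $a=\infty$), i.e. $f$ has a complex extension $f(z)$ analytic at every point of that interval; let $\rho_0\in(0,\infty]$ be the distance from the origin to the nearest singularity of $f(z)$ ($\rho_0=\infty$ if $f$ is entire). Let $0<\omega<\min(a,\rho_0)$. If $a=\infty$, assume in addition that $\lim_{A\to\infty}\mathrm{PV}\!\int_0^A \frac{x f(x)}{\omega^2-x^2}\,dx$ exists, or that $x^{-1}f(x)$ is (possibly conditionally) integrable at infinity, i.e. $\lim_{A\to\infty}\int_1^A x^{-1}f(x)\,dx$ exists. Here, for $A<\infty$, the finite part $\mathrm{f.p.}\!\!\int_0^A h(x)\,dx$ is $\lim_{\varepsilon\to0^+}C_\varepsilon$, where $\int_\varepsilon^A h(x)\,dx=C_\varepsilon+D_\varepsilon$ with $D_\varepsilon$ a finite linear combination of $\ln\varepsilon$ and of powers $\varepsilon^{-p}$, $p>0$, and $C_\varepsilon$ convergent as $\varepsilon\to0^+$. The principal value is the Cauchy principal value at $x=\omega$. All integrals (principal value, finite part, ordinary) with upper limit $\infty$ are the limits, as $A\to\infty$, of those with upper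 limit $A$. (1) If $f(0)\neq0$, then the principal value and all the finite parts below exist, the series converges absolutely, and $$\mathrm{PV}\!\int_0^a\frac{x f(x)}{\omega^2-x^2}\,dx=-\sum_{k=0}^\infty\omega^{2k}\,\mathrm{f.p.}\!\!\int_0^a\frac{f(x)}{x^{2k+1}}\,dx+\tfrac12\,[f(\omega)+f(-\omega)]\ln\omega .$$ (2) If moreover $f$ is even (i.e. $f(-x)=f(x)$ for real $|x|<\rho_0$), then $$\mathrm{PV}\!\int_0^a\frac{x f(x)}{\omega^2-x^2}\,dx=-\sum_{k=0}^\infty\omega^{2k}\,\mathrm{f.p.}\!\!\int_0^a\frac{f(x)}{x^{2k+1}}\,dx+f(\omega)\ln\omega .$$ (3) If instead $f(z)=z^m g(z)$ with an integer $m\ge1$ and $g$ analytic at $0$ with $g(0)\ne0$, then the principal value, the integrals and the finite parts below exist, the series converges absolutely, and $$\mathrm{PV}\!\int_0^a\frac{x f(x)}{\omega^2-x^2}\,dx=-\sum_{k=0}^{\lfloor (m-1)/2\rfloor}\omega^{2k}\int_0^a x^{m-2k-1}g(x)\,dx-\sum_{k=0}^\infty\omega^{2k+2\lfloor (m+1)/2\rfloor}\,\mathrm{f.p.}\!\!\int_0^a\frac{x^m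 g(x)}{x^{2k+2\lfloor (m+1)/2\rfloor+1}}\,dx+\frac{\omega^m}{2}\,[g(\omega)+(-1)^m g(-\omega)]\ln\omega .$$ The last term vanishes when $g$ is even and $m$ is odd. -/

import Mathlib

open Filter Topology MeasureTheory
open scoped ENNReal

namespace FinitePart

/-- `f` is complex analytic in the interval `[0, a]`, `a ≤ ∞` (in `[0, ∞)` when `a = ∞`): the complex
function `f` is analytic at each point of that interval of the real axis. -/
def ComplexAnalyticOn (f : ℂ → ℂ) (a : WithTop ℝ) : Prop :=
  ∀ x : ℝ, 0 ≤ x → (x : WithTop ℝ) ≤ a → AnalyticAt ℂ f (x : ℂ)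

/-- The distance from the origin to the nearest singularity of `f` (it is `∞` when `f` is entire). -/
noncomputable def singularityDist (f : ℂ → ℂ) : ℝ≥0∞ :=
  ⨅ (z : ℂ) (_ : ¬ AnalyticAt ℂ f z), ENNReal.ofReal ‖z‖

/-- `f` is an even function of the real variable `x`, for `|x| < r`. -/
def EvenWithin (f : ℂ → ℂ) (r : ℝ≥0∞) : Prop :=
  ∀ x : ℝ, ENNReal.ofReal |x| < r → f (-(x : ℂ)) = f (x : ℂ)

/-- `P A v` says that the integral (in some sense) with upper limit `A < ∞` exists with value `v`.
For the upper limit `∞` the integral is the limit of the integrals up to `A` as `A → ∞`. -/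
def UpTo (P : ℝ → ℂ → Prop) : WithTop ℝ → ℂ → Prop
  | (A : ℝ), L => P A L
  | ⊤, L => ∃ v : ℝ → ℂ, (∀ᶠ A in atTop, P A (v A)) ∧ Tendsto v atTop (𝓝 L)

/-- The integral of `h` over `[0, a]`, `a ≤ ∞`, exists and equals `L` (for `a = ∞`, as a limit). -/
def HasIntegral (h : ℝ → ℂ) (a : WithTop ℝ) (L : ℂ) : Prop :=
  UpTo (fun A v => IntervalIntegrable h volume 0 A ∧ ∫ x in (0 : ℝ)..A, h x = v) a L

/-- The Cauchy principal value, at the point `ω` with `0 < ω < A`, of the integral of `h` over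
`[0, A]` exists and equals `v`. -/
def HasPVReal (h : ℝ → ℂ) (ω A : ℝ) (v : ℂ) : Prop :=
  0 < ω ∧ ω < A ∧
  (∀ᶠ ε in 𝓝[>] (0 : ℝ),
    IntervalIntegrable h volume 0 (ω - ε) ∧ IntervalIntegrable h volume (ω + ε) A) ∧
  Tendsto (fun ε : ℝ => (∫ x in (0 : ℝ)..(ω - ε), h x) + ∫ x in (ω + ε)..A, h x)
    (𝓝[>] 0) (𝓝 v)

/-- The principal value of the integral of `h` over `[0, a]`, `a ≤ ∞`, exists and equals `L`. -/
def HasPV (h : ℝ → ℂ) (ω : ℝ) (a : WithTop ℝ) (L : ℂ) : Prop :=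
  UpTo (HasPVReal h ω) a L

/-- The finite part of the integral of `h` over `[0, A]`, `0 < A < ∞`, exists and equals `v`:
the integral over `[ε, A]` is `C ε + D ε`, where `D ε` is a finite linear combination of diverging
powers `ε ^ (-p)`, `p > 0`, and of `log ε`, and where `C ε` tends to `v` as `ε → 0+`. -/
def HasFinitePartReal (h : ℝ → ℂ) (A : ℝ) (v : ℂ) : Prop :=
  0 < A ∧ (∀ ε : ℝ, 0 < ε → ε < A → IntervalIntegrable h volume ε A) ∧
  ∃ (s : Finset ℝ) (c : ℝ → ℂ) (b : ℂ), (∀ p ∈ s, 0 < p) ∧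
    Tendsto (fun ε : ℝ => (∫ x in ε..A, h x)
        - ((∑ p ∈ s, c p * ((ε ^ (-p) : ℝ) : ℂ)) + b * (Real.log ε : ℂ)))
      (𝓝[>] 0) (𝓝 v)

/-- The finite part of the integral of `h` over `[0, a]`, `a ≤ ∞`, exists and equals `L`. -/
def HasFinitePart (h : ℝ → ℂ) (a : WithTop ℝ) (L : ℂ) : Prop :=
  UpTo (HasFinitePartReal h) a L

end FinitePart

namespace FinitePart

theorem asymp_aux (s : Finset ℝ) : ∀ (c : ℝ → ℂ) (b L : ℂ), (∀ p ∈ s, 0 < p) →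
    Tendsto (fun ε : ℝ => (∑ p ∈ s, c p * ((ε ^ (-p) : ℝ) : ℂ)) + b * (Real.log ε : ℂ))
      (𝓝[>] 0) (𝓝 L) → L = 0 := by
  induction s using Finset.induction_on_max with
  | empty =>
    intro c b L _ h
    simp only [Finset.sum_empty, zero_add] at h
    by_cases hb : b = 0
    · subst hb
      simp only [zero_mul] at h
      exact tendsto_nhds_unique h tendsto_const_nhds
    · exfalso
      have h1 : Tendsto (fun ε : ℝ => ‖b * (Real.log ε : ℂ)‖) (𝓝[>] 0) atTop := by
        have : Tendsto (fun ε : ℝ => ‖b‖ * |Real.log ε|) (𝓝[>] 0) atTop :=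
          (tendsto_abs_atBot_atTop.comp Real.tendsto_log_nhdsGT_zero).const_mul_atTop
            (norm_pos_iff.2 hb)
        refine this.congr fun ε => ?_
        rw [norm_mul, Complex.norm_real, Real.norm_eq_abs]
      exact not_tendsto_nhds_of_tendsto_atTop h1 _ h.norm
  | insert q s hq ih =>
    intro c b L hpos h
    have hq0 : 0 < q := hpos q (by simp)
    have hns : q ∉ s := fun hm => lt_irrefl _ (hq q hm)
    have hpow : ∀ r : ℝ, 0 < r → Tendsto (fun ε : ℝ => ((ε ^ r : ℝ) : ℂ)) (𝓝[>] 0) (𝓝 0) := by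
      intro r hr
      have : Tendsto (fun ε : ℝ => ε ^ r) (𝓝[>] 0) (𝓝 0) := by
        have h2 := (Real.continuousAt_rpow_const 0 r (Or.inr hr.le)).tendsto
        rw [Real.zero_rpow hr.ne'] at h2
        exact h2.mono_left nhdsWithin_le_nhds
      exact_mod_cast (Complex.continuous_ofReal.tendsto 0).comp this
    have hlog : Tendsto (fun ε : ℝ => ((ε ^ q : ℝ) : ℂ) * (Real.log ε : ℂ)) (𝓝[>] 0) (𝓝 0) := by
      have h2 := tendsto_log_mul_rpow_nhdsGT_zero hq0
      have h3 := (Complex.continuous_ofReal.tendsto 0).comp h2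
      rw [Complex.ofReal_zero] at h3
      refine h3.congr fun ε => ?_
      simp [mul_comm]
    have hlim := (hpow q hq0).mul h
    rw [zero_mul] at hlim
    have hlim2 : Tendsto (fun ε : ℝ => c q + (∑ p ∈ s, c p * ((ε ^ (q - p) : ℝ) : ℂ))
        + b * (((ε ^ q : ℝ) : ℂ) * (Real.log ε : ℂ))) (𝓝[>] 0)
        (𝓝 (c q + (∑ p ∈ s, c p * 0) + b * 0)) := by
      refine (tendsto_const_nhds.add (tendsto_finsetSum _ fun p hp => ?_)).add (hlog.const_mul b)
      exact (hpow (q - p) (sub_pos.2 (hq p hp))).const_mul _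
    have hcq : c q = 0 := by
      have := tendsto_nhds_unique (hlim.congr' ?_) hlim2
      · simpa using this.symm
      · filter_upwards [self_mem_nhdsWithin] with ε hε
        have hε' : (0 : ℝ) < ε := hε
        have e1 : ∀ p : ℝ, ((ε ^ q : ℝ) : ℂ) * (c p * ((ε ^ (-p) : ℝ) : ℂ))
            = c p * ((ε ^ (q - p) : ℝ) : ℂ) := by
          intro p
          rw [sub_eq_add_neg, Real.rpow_add hε']
          push_cast
          ring
        rw [Finset.sum_insert hns, mul_add, mul_add, e1, Finset.mul_sum]
        simp only [e1, sub_self, Real.rpow_zero, Complex.ofReal_one, mul_one]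
        ring
    refine ih c b L (fun p hp => hpos p (Finset.mem_insert_of_mem hp)) (h.congr fun ε => ?_)
    rw [Finset.sum_insert hns, hcq, zero_mul, zero_add]

/-- The finite part is unique. -/
theorem HasFinitePartReal.unique {h : ℝ → ℂ} {A : ℝ} {v w : ℂ}
    (hv : HasFinitePartReal h A v) (hw : HasFinitePartReal h A w) : v = w := by
  classical
  obtain ⟨-, -, s, c, b, hs, h1⟩ := hv
  obtain ⟨-, -, t, d, e, ht, h2⟩ := hw
  have h3 := h1.sub h2
  refine sub_eq_zero.1 (asymp_aux (s ∪ t)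
    (fun p => (if p ∈ t then d p else 0) - (if p ∈ s then c p else 0)) (e - b) (v - w) ?_ ?_)
  · intro p hp
    rcases Finset.mem_union.1 hp with h | h
    · exact hs p h
    · exact ht p h
  · refine h3.congr fun ε => ?_
    have a1 : ∑ p ∈ s ∪ t, (if p ∈ s then c p else 0) * ((ε ^ (-p) : ℝ) : ℂ)
        = ∑ p ∈ s, c p * ((ε ^ (-p) : ℝ) : ℂ) := by
      rw [← Finset.sum_subset (Finset.subset_union_left (s₁ := s) (s₂ := t))]
      · exact Finset.sum_congr rfl fun p hp => by rw [if_pos hp]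
      · intro p _ hp
        rw [if_neg hp, zero_mul]
    have a2 : ∑ p ∈ s ∪ t, (if p ∈ t then d p else 0) * ((ε ^ (-p) : ℝ) : ℂ)
        = ∑ p ∈ t, d p * ((ε ^ (-p) : ℝ) : ℂ) := by
      rw [← Finset.sum_subset (Finset.subset_union_right (s₁ := s) (s₂ := t))]
      · exact Finset.sum_congr rfl fun p hp => by rw [if_pos hp]
      · intro p _ hp
        rw [if_neg hp, zero_mul]
    simp only [sub_mul, Finset.sum_sub_distrib, a1, a2]
    ring

theorem HasFinitePart.unique {h : ℝ → ℂ} {a : WithTop ℝ} {v w : ℂ}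
    (hv : HasFinitePart h a v) (hw : HasFinitePart h a w) : v = w := by
  cases a with
  | coe A => exact HasFinitePartReal.unique hv hw
  | top =>
    obtain ⟨x, hx, hx'⟩ := hv
    obtain ⟨y, hy, hy'⟩ := hw
    refine tendsto_nhds_unique hx' (hy'.congr' ?_)
    filter_upwards [hx, hy] with A h1 h2
    exact h2.unique h1

theorem HasPV.unique {h : ℝ → ℂ} {ω : ℝ} {a : WithTop ℝ} {v w : ℂ}
    (hv : HasPV h ω a v) (hw : HasPV h ω a w) : v = w := by
  cases a with
  | coe A => exact tendsto_nhds_unique hv.2.2.2 hw.2.2.2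
  | top =>
    obtain ⟨x, hx, hx'⟩ := hv
    obtain ⟨y, hy, hy'⟩ := hw
    refine tendsto_nhds_unique hx' (hy'.congr' ?_)
    filter_upwards [hx, hy] with A h1 h2
    exact tendsto_nhds_unique h2.2.2.2 h1.2.2.2

end FinitePart

namespace FinitePart

/-! Write `u(x) = x f(x) / (ω² - x²)`. Then `f(x) / x^(2k+1) = ω² u(x) / x^(2k+2) - u(x) / x^(2k)`,
so multiplying by `ω^(2k)` and summing over `k` formally telescopes to `-u(x)`. The series of finite
parts is therefore `-PV ∫ u` plus a correction produced by the pole at `ω` and the regularization at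
`0`. To make this rigorous, cut at some `R` with `ω < R < min(a, ρ₀)`.

On `[R, a]` the telescoping is literal: `∫ u / x^(2N)` is `O(R^(-2N))` and `ω < R`
(`hasSum_telescope`). When `u` is only conditionally integrable the bound comes from Dirichlet's
test (`exists_tendsto_integral_mul`).

On `[0, R]`, interpolate `f` at `±ω`: `f(z) = α + β z + (ω² - z²) g(z)` with `g` analytic in the
disc (`exists_eq_linear_add_mul`). The `g` part telescopes again, now with finite parts bounded
through the Taylor series (`exists_hasFinitePartReal_div_pow`). The functions `1` and `x` are
computed explicitly: `x` leaves no correction, `1` leaves `log ω`, and `α = (f(ω) + f(-ω)) / 2`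
gives the stated logarithmic term. -/

/-! ### Calculus of finite parts, principal values and improper integrals. -/

/-- The integral of `h` over `[R, a]`, `a ≤ ∞`, exists and equals `L`. -/
def HasTailIntegral (h : ℝ → ℂ) (R : ℝ) (a : WithTop ℝ) (L : ℂ) : Prop :=
  UpTo (fun A v => IntervalIntegrable h volume R A ∧ ∫ x in R..A, h x = v) a L

/-- This treats finite and infinite upper limits together: a pointwise implication is only needed
for `R < A ≤ a`, since large `A` suffice when `a = ∞`. -/
theorem UpTo.map {P Q : ℝ → ℂ → Prop} {φ : ℂ → ℂ} (hφ : Continuous φ) {R : ℝ} {a : WithTop ℝ}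
    {L : ℂ} (hRa : (R : WithTop ℝ) < a)
    (hPQ : ∀ (A : ℝ) (v : ℂ), (A : WithTop ℝ) ≤ a → R < A → P A v → Q A (φ v))
    (h : UpTo P a L) : UpTo Q a (φ L) := by
  cases a with
  | coe A => exact hPQ A L le_rfl (WithTop.coe_lt_coe.1 hRa) h
  | top =>
    obtain ⟨v, hv, hv'⟩ := h
    refine ⟨fun A => φ (v A), ?_, (hφ.tendsto L).comp hv'⟩
    filter_upwards [hv, eventually_gt_atTop R] with A hA hRA
    exact hPQ A _ le_top hRA hA

/-- The shape `c * v - w` is that of the telescoping difference `ω² D (k + 1) - D k`. -/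
theorem UpTo.map₂ {P Q S : ℝ → ℂ → Prop} {a : WithTop ℝ} {L M : ℂ} (c : ℂ)
    (hS : ∀ (A : ℝ) (v w : ℂ), (A : WithTop ℝ) ≤ a → P A v → Q A w → S A (c * v - w))
    (h : UpTo P a L) (h' : UpTo Q a M) : UpTo S a (c * L - M) := by
  cases a with
  | coe A => exact hS A L M le_rfl h h'
  | top =>
    obtain ⟨v, hv, hv'⟩ := h
    obtain ⟨w, hw, hw'⟩ := h'
    refine ⟨fun A => c * v A - w A, ?_, (hv'.const_mul c).sub hw'⟩
    filter_upwards [hv, hw] with A hA hB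
    exact hS A _ _ le_top hA hB

theorem HasFinitePartReal.congr {h h' : ℝ → ℂ} {A : ℝ} {v : ℂ} (hv : HasFinitePartReal h A v)
    (hh : ∀ x, 0 < x → x ≤ A → h x = h' x) : HasFinitePartReal h' A v := by
  obtain ⟨hA, hi, s, c, b, hs, ht⟩ := hv
  have key : ∀ ε : ℝ, 0 < ε → ε < A → Set.EqOn h h' (Set.uIoc ε A) := fun ε h0 h1 x hx => by
    rw [Set.uIoc_of_le h1.le] at hx
    exact hh x (h0.trans hx.1) hx.2
  refine ⟨hA, fun ε h0 h1 => (hi ε h0 h1).congr (key ε h0 h1), s, c, b, hs, ht.congr' ?_⟩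
  filter_upwards [Ioo_mem_nhdsGT hA] with ε hε
  rw [intervalIntegral.integral_congr_ae (Eventually.of_forall (key ε hε.1 hε.2))]

theorem HasFinitePartReal.add {h h' : ℝ → ℂ} {A : ℝ} {v w : ℂ} (hv : HasFinitePartReal h A v)
    (hw : HasFinitePartReal h' A w) : HasFinitePartReal (fun x => h x + h' x) A (v + w) := by
  classical
  obtain ⟨hA, hi, s, c, b, hs, h1⟩ := hv
  obtain ⟨-, hi', t, d, e, ht, h2⟩ := hw
  refine ⟨hA, fun ε h0 h1 => (hi ε h0 h1).add (hi' ε h0 h1), s ∪ t,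
    fun p => (if p ∈ s then c p else 0) + (if p ∈ t then d p else 0), b + e, ?_, ?_⟩
  · intro p hp
    rcases Finset.mem_union.1 hp with h | h
    · exact hs p h
    · exact ht p h
  · refine (h1.add h2).congr' ?_
    filter_upwards [Ioo_mem_nhdsGT hA] with ε hε
    have a1 : ∀ (s' : Finset ℝ) (c' : ℝ → ℂ), s' ⊆ s ∪ t →
        ∑ p ∈ s ∪ t, (if p ∈ s' then c' p else 0) * ((ε ^ (-p) : ℝ) : ℂ)
        = ∑ p ∈ s', c' p * ((ε ^ (-p) : ℝ) : ℂ) := by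
      intro s' c' hs'
      rw [← Finset.sum_subset hs']
      · exact Finset.sum_congr rfl fun p hp => by rw [if_pos hp]
      · intro p _ hp
        rw [if_neg hp, zero_mul]
    simp only [add_mul, Finset.sum_add_distrib, a1 s c Finset.subset_union_left,
      a1 t d Finset.subset_union_right]
    rw [intervalIntegral.integral_add (hi ε hε.1 hε.2) (hi' ε hε.1 hε.2)]
    ring

theorem HasFinitePartReal.const_mul {h : ℝ → ℂ} {A : ℝ} {v : ℂ} (k : ℂ)
    (hv : HasFinitePartReal h A v) : HasFinitePartReal (fun x => k * h x) A (k * v) := by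
  obtain ⟨hA, hi, s, c, b, hs, h1⟩ := hv
  refine ⟨hA, fun ε h0 h1 => (hi ε h0 h1).const_mul k, s, fun p => k * c p, k * b, hs, ?_⟩
  refine (h1.const_mul k).congr fun ε => ?_
  rw [intervalIntegral.integral_const_mul, mul_sub, mul_add, Finset.mul_sum]
  simp only [mul_assoc]

theorem tendsto_integral_nhdsGT {h : ℝ → ℂ} {A : ℝ} (hA : 0 < A)
    (hi : IntervalIntegrable h volume 0 A) :
    Tendsto (fun ε : ℝ => ∫ x in ε..A, h x) (𝓝[>] 0) (𝓝 (∫ x in (0 : ℝ)..A, h x)) := by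
  have hc := intervalIntegral.continuousOn_primitive_interval' hi.symm Set.left_mem_uIcc
  have h0 : Tendsto (fun ε => ∫ x in A..ε, h x) (𝓝[>] 0) (𝓝 (∫ x in A..(0 : ℝ), h x)) := by
    refine (hc 0 Set.right_mem_uIcc).mono_left ?_
    rw [Set.uIcc_of_ge hA.le]
    exact nhdsWithin_le_of_mem (Icc_mem_nhdsGT hA)
  refine (h0.neg).congr' ?_ |>.trans_eq ?_
  · exact Eventually.of_forall fun ε => (intervalIntegral.integral_symm _ _).symm
  · rw [intervalIntegral.integral_symm A 0]

theorem HasFinitePartReal.of_integrable {h : ℝ → ℂ} {A : ℝ} (hA : 0 < A)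
    (hi : IntervalIntegrable h volume 0 A) :
    HasFinitePartReal h A (∫ x in (0 : ℝ)..A, h x) := by
  refine ⟨hA, fun ε h0 h1 => hi.mono_set ?_, ∅, 0, 0, by simp, ?_⟩
  · rw [Set.uIcc_of_le h1.le, Set.uIcc_of_le hA.le]
    exact Set.Icc_subset_Icc h0.le le_rfl
  · simpa using tendsto_integral_nhdsGT hA hi

theorem HasFinitePartReal.zero {A : ℝ} (hA : 0 < A) : HasFinitePartReal (fun _ => 0) A 0 := by
  simpa using HasFinitePartReal.of_integrable hA
    (intervalIntegrable_const (c := (0 : ℂ)) (μ := volume))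

theorem HasFinitePartReal.sum {ι : Type*} (t : Finset ι) {h : ι → ℝ → ℂ} {A : ℝ} {v : ι → ℂ}
    (hA : 0 < A) (hv : ∀ i ∈ t, HasFinitePartReal (h i) A (v i)) :
    HasFinitePartReal (fun x => ∑ i ∈ t, h i x) A (∑ i ∈ t, v i) := by
  classical
  induction t using Finset.induction_on with
  | empty => simpa using HasFinitePartReal.zero hA
  | insert i t hi ih =>
    simp only [Finset.sum_insert hi]
    exact (hv i (Finset.mem_insert_self i t)).add
      (ih fun j hj => hv j (Finset.mem_insert_of_mem hj))

/-- The divergence sits at the origin, so the same diverging terms serve for `R` and for `A`. -/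
theorem HasFinitePartReal.extend {h : ℝ → ℂ} {R A : ℝ} {v w : ℂ} (hv : HasFinitePartReal h R v)
    (hRA : R < A) (hi : IntervalIntegrable h volume R A) (hw : ∫ x in R..A, h x = w) :
    HasFinitePartReal h A (v + w) := by
  obtain ⟨hR, hi', s, c, b, hs, h1⟩ := hv
  refine ⟨hR.trans hRA, fun ε h0 h1 => ?_, s, c, b, hs, (h1.add_const w).congr' ?_⟩
  · rcases lt_or_ge ε R with h | h
    · exact (hi' ε h0 h).trans hi
    · refine hi.mono_set ?_
      rw [Set.uIcc_of_le h1.le, Set.uIcc_of_le hRA.le]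
      exact Set.Icc_subset_Icc h le_rfl
  · filter_upwards [Ioo_mem_nhdsGT hR] with ε hε
    rw [← hw, ← intervalIntegral.integral_add_adjacent_intervals (hi' ε hε.1 hε.2) hi]
    ring

theorem HasPVReal.extend {h : ℝ → ℂ} {ω R A : ℝ} {v w : ℂ} (hv : HasPVReal h ω R v)
    (hRA : R < A) (hi : IntervalIntegrable h volume R A) (hw : ∫ x in R..A, h x = w) :
    HasPVReal h ω A (v + w) := by
  obtain ⟨h0, hωR, hi', h1⟩ := hv
  refine ⟨h0, hωR.trans hRA, ?_, (h1.add_const w).congr' ?_⟩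
  · filter_upwards [hi'] with ε hε
    exact ⟨hε.1, hε.2.trans hi⟩
  · filter_upwards [hi'] with ε hε
    rw [← hw, ← intervalIntegral.integral_add_adjacent_intervals hε.2 hi]
    ring

theorem HasPV.of_tail {h : ℝ → ℂ} {ω R : ℝ} {a : WithTop ℝ} {v w : ℂ} (hRa : (R : WithTop ℝ) < a)
    (hv : HasPVReal h ω R v) (hw : HasTailIntegral h R a w) : HasPV h ω a (v + w) :=
  UpTo.map (continuous_const.add continuous_id) hRa
    (fun _ _ _ hRA hA => hv.extend hRA hA.1 hA.2) hw

theorem HasFinitePart.of_tail {h : ℝ → ℂ} {R : ℝ} {a : WithTop ℝ} {v w : ℂ}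
    (hRa : (R : WithTop ℝ) < a)
    (hv : HasFinitePartReal h R v) (hw : HasTailIntegral h R a w) : HasFinitePart h a (v + w) :=
  UpTo.map (continuous_const.add continuous_id) hRa
    (fun _ _ _ hRA hA => hv.extend hRA hA.1 hA.2) hw

/-- A finite part is an ordinary integral when the integrand is integrable up to the origin. -/
theorem HasFinitePart.hasIntegral {h h' : ℝ → ℂ} {a : WithTop ℝ} {L : ℂ}
    (ha : ((0 : ℝ) : WithTop ℝ) < a) (hL : HasFinitePart h a L)
    (hi : ∀ A : ℝ, 0 < A → (A : WithTop ℝ) ≤ a → IntervalIntegrable h' volume 0 A)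
    (hh : ∀ x : ℝ, 0 < x → (x : WithTop ℝ) ≤ a → h x = h' x) : HasIntegral h' a L := by
  refine UpTo.map continuous_id ha (fun A v hAa hA hv => ⟨hi A hA hAa, ?_⟩) hL
  refine (HasFinitePartReal.of_integrable hA (hi A hA hAa)).unique (hv.congr fun x h0 h1 => ?_)
  exact hh x h0 ((WithTop.coe_le_coe.2 h1).trans hAa)

theorem intervalIntegrable_of_continuousAt {h : ℝ → ℂ} {a b : ℝ} (hab : a ≤ b)
    (hc : ∀ x, a ≤ x → x ≤ b → ContinuousAt h x) : IntervalIntegrable h volume a b :=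
  ContinuousOn.intervalIntegrable_of_Icc hab fun x hx => (hc x hx.1 hx.2).continuousWithinAt

/-! ### Finite parts of monomials. -/

/-- The antiderivative is a pure negative power: its value at `ε` is discarded and only the boundary
term at `R` survives. -/
theorem hasFinitePartReal_pow_div_pow {R : ℝ} (hR : 0 < R) {n j : ℕ} (hnj : n < j) :
    HasFinitePartReal (fun x : ℝ => (x : ℂ) ^ n / (x : ℂ) ^ (j + 1)) R
      (-(1 / (((j - n : ℕ) : ℂ) * (R : ℂ) ^ (j - n)))) := by
  obtain ⟨d, rfl⟩ := Nat.exists_eq_add_of_lt hnj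
  have e : n + d + 1 - n = d + 1 := by omega
  rw [e]
  have hd : ((d + 1 : ℕ) : ℂ) ≠ 0 := by exact_mod_cast d.succ_ne_zero
  have hder : ∀ x : ℝ, x ≠ 0 → HasDerivAt
      (fun y : ℝ => -(1 / (((d + 1 : ℕ) : ℂ) * (y : ℂ) ^ (d + 1))))
      ((x : ℂ) ^ n / (x : ℂ) ^ (n + d + 1 + 1)) x := by
    intro x hx
    have hx' : (x : ℂ) ≠ 0 := by exact_mod_cast hx
    have h1 : HasDerivAt (fun y : ℝ => ((d + 1 : ℕ) : ℂ) * (y : ℂ) ^ (d + 1))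
        (((d + 1 : ℕ) : ℂ) * (((d + 1 : ℕ) : ℂ) * (x : ℂ) ^ d * 1)) x := by
      have := (Complex.ofRealCLM.hasDerivAt (x := x)).pow (d + 1)
      simpa using this.const_mul ((d + 1 : ℕ) : ℂ)
    have h2 := (h1.inv (mul_ne_zero hd (pow_ne_zero _ hx'))).neg
    simp only [one_div]
    refine h2.congr_deriv ?_
    field_simp
    ring
  have hcont : ∀ ε : ℝ, 0 < ε → ε < R → IntervalIntegrable
      (fun x : ℝ => (x : ℂ) ^ n / (x : ℂ) ^ (n + d + 1 + 1)) volume ε R := fun ε h0 h1 => by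
    refine intervalIntegrable_of_continuousAt h1.le fun x hx _ => ?_
    have : (x : ℂ) ≠ 0 := by exact_mod_cast (h0.trans_le hx).ne'
    exact ContinuousAt.div (by fun_prop) (by fun_prop) (pow_ne_zero _ this)
  refine ⟨hR, hcont, {((d + 1 : ℕ) : ℝ)}, fun _ => 1 / ((d + 1 : ℕ) : ℂ), 0, ?_, ?_⟩
  · intro p hp
    rw [Finset.mem_singleton.1 hp]
    positivity
  · refine tendsto_const_nhds.congr' ?_
    filter_upwards [Ioo_mem_nhdsGT hR] with ε hε
    have hε0 : (ε : ℂ) ≠ 0 := by exact_mod_cast hε.1.ne'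
    rw [intervalIntegral.integral_eq_sub_of_hasDerivAt
      (fun x hx => hder x ?_) (hcont ε hε.1 hε.2)]
    · rw [Finset.sum_singleton, Real.rpow_neg hε.1.le, Real.rpow_natCast]
      push_cast
      simp only [one_div, mul_inv]
      ring
    · rw [Set.uIcc_of_le hε.2.le] at hx
      exact (hε.1.trans_le hx.1).ne'

theorem hasFinitePartReal_pow_div_pow_succ {R : ℝ} (hR : 0 < R) (j : ℕ) :
    HasFinitePartReal (fun x : ℝ => (x : ℂ) ^ j / (x : ℂ) ^ (j + 1)) R (Real.log R : ℂ) := by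
  have hder : ∀ x : ℝ, x ≠ 0 → HasDerivAt (fun y : ℝ => (Real.log y : ℂ))
      ((x : ℂ) ^ j / (x : ℂ) ^ (j + 1)) x := by
    intro x hx
    have hx' : (x : ℂ) ≠ 0 := by exact_mod_cast hx
    refine ((Real.hasDerivAt_log hx).ofReal_comp).congr_deriv ?_
    push_cast
    field_simp
    ring
  have hcont : ∀ ε : ℝ, 0 < ε → ε < R → IntervalIntegrable
      (fun x : ℝ => (x : ℂ) ^ j / (x : ℂ) ^ (j + 1)) volume ε R := fun ε h0 h1 => by
    refine intervalIntegrable_of_continuousAt h1.le fun x hx _ => ?_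
    have : (x : ℂ) ≠ 0 := by exact_mod_cast (h0.trans_le hx).ne'
    exact ContinuousAt.div (by fun_prop) (by fun_prop) (pow_ne_zero _ this)
  -- The integral is `log R - log ε`, hence the coefficient `-1`.
  refine ⟨hR, hcont, ∅, 0, -1, by simp, ?_⟩
  refine tendsto_const_nhds.congr' ?_
  filter_upwards [Ioo_mem_nhdsGT hR] with ε hε
  rw [intervalIntegral.integral_eq_sub_of_hasDerivAt
    (fun x hx => hder x ?_) (hcont ε hε.1 hε.2)]
  · simp
  · rw [Set.uIcc_of_le hε.2.le] at hx
    exact (hε.1.trans_le hx.1).ne'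

/-! ### Telescoping, and geometric decay of finite parts. -/

/-- With `E k = ω^(2k) D k` the summand is `E (k + 1) - E k`, and `E` is summable by comparison with
the geometric series of ratio `(ω / R)²`. -/
theorem hasSum_telescope {D : ℕ → ℂ} {C ω R : ℝ} (hω : 0 < ω) (hωR : ω < R)
    (hD : ∀ k, ‖D k‖ ≤ C / R ^ (2 * k)) :
    HasSum (fun k : ℕ => (ω : ℂ) ^ (2 * k) * ((ω : ℂ) ^ 2 * D (k + 1) - D k)) (-D 0) := by
  have hR := hω.trans hωR
  have hq : (ω / R) ^ 2 < 1 := pow_lt_one₀ (by positivity) ((div_lt_one hR).2 hωR) two_ne_zero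
  have hE : Summable fun k : ℕ => (ω : ℂ) ^ (2 * k) * D k := by
    refine Summable.of_norm_bounded
      ((summable_geometric_of_lt_one (by positivity) hq).mul_left C) fun k => ?_
    rw [norm_mul, norm_pow, Complex.norm_real, Real.norm_of_nonneg hω.le]
    calc ω ^ (2 * k) * ‖D k‖ ≤ ω ^ (2 * k) * (C / R ^ (2 * k)) := by gcongr; exact hD k
      _ = C * ((ω / R) ^ 2) ^ k := by rw [← pow_mul, div_pow]; ring
  have h1 := (hasSum_nat_add_iff' 1).2 hE.hasSum
  refine ((h1.sub hE.hasSum).congr_fun ?_).trans_eq ?_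
  · intro k
    ring
  · simp

/-- Finite parts of `φ x / x ^ (j + 1)` over `[0, R]` exist and decay geometrically when `φ` is
analytic in a disc of radius larger than `R`. -/
theorem exists_hasFinitePartReal_div_pow {φ : ℂ → ℂ} {R ρ : ℝ} (hR : 0 < R) (hRρ : R < ρ)
    (hφ : DifferentiableOn ℂ φ (Metric.ball 0 ρ)) :
    ∃ C : ℝ, ∀ j : ℕ, ∃ v : ℂ,
      HasFinitePartReal (fun x : ℝ => φ x / (x : ℂ) ^ (j + 1)) R v ∧ ‖v‖ ≤ C / R ^ j := by
  -- The room between `R` and `r` makes the Taylor series absolutely summable at radius `R`.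
  obtain ⟨r, hRr, hrρ⟩ := exists_between hRρ
  have hr : 0 < r := hR.trans hRr
  have hball := (hφ.mono (Metric.closedBall_subset_ball hrρ)).hasFPowerSeriesOnBall
    (R := ⟨r, hr.le⟩) (c := 0) hr
  set p := cauchyPowerSeries φ 0 (⟨r, hr.le⟩ : NNReal)
  set c : ℕ → ℂ := fun n => p.coeff n
  have hsum : Summable fun n => ‖c n‖ * R ^ n := by
    have := p.summable_norm_mul_pow (r := ⟨R, hR.le⟩)
      (lt_of_lt_of_le (ENNReal.coe_lt_coe.2 (show (⟨R, hR.le⟩ : NNReal) < ⟨r, hr.le⟩ from hRr))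
        hball.r_le)
    refine this.congr fun n => ?_
    rw [FormalMultilinearSeries.norm_apply_eq_norm_coef]
    rfl
  have hφs : ∀ z : ℂ, ‖z‖ ≤ R → HasSum (fun n => c n * z ^ n) (φ z) := by
    intro z hz
    have := hball.hasSum (y := z) (by
      rw [mem_eball_zero_iff, enorm_eq_nnnorm]
      exact ENNReal.coe_lt_coe.2 (show ‖z‖₊ < ⟨r, hr.le⟩ from hz.trans_lt hRr))
    rw [zero_add] at this
    refine this.congr_fun fun n => ?_
    rw [FormalMultilinearSeries.apply_eq_pow_smul_coeff, smul_eq_mul, mul_comm]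
    rfl
  set S := ∑' n, ‖c n‖ * R ^ n
  have hS : 0 ≤ S := tsum_nonneg fun n => by positivity
  -- The three summands bound the Taylor terms of degree below `j`, the logarithmic term of degree
  -- `j`, and the remainder.
  refine ⟨S + S * |Real.log R| + S, fun j => ?_⟩
  -- The Taylor tail from degree `j + 1`, divided by `x^(j+1)`: continuous up to the origin.
  set q : ℝ → ℂ := fun x => ∑' n, c (n + (j + 1)) * (x : ℂ) ^ n
  have hbd : ∀ n : ℕ, ∀ x ∈ Set.Icc (0 : ℝ) R,
      ‖c (n + (j + 1)) * (x : ℂ) ^ n‖ ≤ ‖c (n + (j + 1))‖ * R ^ n := by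
    intro n x hx
    rw [norm_mul, norm_pow, Complex.norm_real, Real.norm_of_nonneg hx.1]
    gcongr
    exacts [hx.1, hx.2]
  have hshift : Summable fun n => ‖c (n + (j + 1))‖ * R ^ n := by
    refine (((summable_nat_add_iff (j + 1)).2 hsum).mul_right (R ^ (j + 1))⁻¹).congr fun n => ?_
    rw [pow_add]
    field_simp
  have hqc : ContinuousOn q (Set.Icc 0 R) :=
    continuousOn_tsum (fun n => by fun_prop) hshift hbd
  have hqi : IntervalIntegrable q volume 0 R := hqc.intervalIntegrable_of_Icc hR.le
  have hqn : ∀ x ∈ Set.Icc (0 : ℝ) R, ‖q x‖ ≤ S / R ^ (j + 1) := by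
    intro x hx
    refine (tsum_of_norm_bounded hshift.hasSum fun n => hbd n x hx).trans ?_
    rw [le_div_iff₀ (by positivity), ← tsum_mul_right]
    have h1 := hsum.sum_add_tsum_nat_add (j + 1)
    have h2 : 0 ≤ ∑ i ∈ Finset.range (j + 1), ‖c i‖ * R ^ i :=
      Finset.sum_nonneg fun i _ => by positivity
    simp only [mul_assoc, ← pow_add]
    exact (le_add_of_nonneg_left h2).trans h1.le
  have hval : ∀ x : ℝ, 0 < x → x ≤ R →
      (∑ n ∈ Finset.range j, c n * ((x : ℂ) ^ n / (x : ℂ) ^ (j + 1)))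
        + c j * ((x : ℂ) ^ j / (x : ℂ) ^ (j + 1)) + q x = φ x / (x : ℂ) ^ (j + 1) := by
    intro x h0 h1
    have hx : (x : ℂ) ^ (j + 1) ≠ 0 := pow_ne_zero _ (by exact_mod_cast h0.ne')
    have hxs := hφs x (by rwa [Complex.norm_real, Real.norm_of_nonneg h0.le])
    have h2 := hxs.summable.sum_add_tsum_nat_add (j + 1)
    rw [hxs.tsum_eq, Finset.sum_range_succ] at h2
    have h3 : ∑' i, c (i + (j + 1)) * (x : ℂ) ^ (i + (j + 1)) = q x * (x : ℂ) ^ (j + 1) := by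
      rw [← tsum_mul_right]
      exact tsum_congr fun n => by rw [pow_add]; ring
    rw [h3] at h2
    rw [eq_div_iff hx, ← h2, add_mul, add_mul, Finset.sum_mul, mul_assoc (c j),
      div_mul_cancel₀ _ hx]
    simp only [mul_assoc, div_mul_cancel₀ _ hx]
  refine ⟨_, (((HasFinitePartReal.sum (Finset.range j) hR fun n hn =>
    (hasFinitePartReal_pow_div_pow hR (Finset.mem_range.1 hn)).const_mul (c n)).add
    ((hasFinitePartReal_pow_div_pow_succ hR j).const_mul (c j))).add
    (HasFinitePartReal.of_integrable hR hqi)).congr hval, ?_⟩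
  rw [add_div, add_div]
  refine norm_add₃_le.trans (add_le_add (add_le_add ?_ ?_) ?_)
  · refine (norm_sum_le _ _).trans ?_
    calc _ ≤ ∑ n ∈ Finset.range j, ‖c n‖ * R ^ n / R ^ j := by
          refine Finset.sum_le_sum fun n hn => ?_
          have hnj := Finset.mem_range.1 hn
          rw [norm_mul, norm_neg, norm_div, norm_mul, norm_one, norm_pow, Complex.norm_real,
            Real.norm_of_nonneg hR.le, Complex.norm_natCast, mul_div_assoc]
          refine mul_le_mul_of_nonneg_left ?_ (norm_nonneg _)
          obtain ⟨d, rfl⟩ := Nat.exists_eq_add_of_lt hnj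
          rw [show n + d + 1 - n = d + 1 by omega, add_assoc, pow_add R n,
            div_mul_cancel_left₀ (by positivity), ← one_div]
          refine one_div_le_one_div_of_le (by positivity) (le_mul_of_one_le_left (by positivity) ?_)
          exact_mod_cast Nat.le_add_left 1 d
      _ ≤ S / R ^ j := by
          rw [← Finset.sum_div]
          gcongr
          exact hsum.sum_le_tsum _ fun i _ => by positivity
  · rw [norm_mul, Complex.norm_real, Real.norm_eq_abs, mul_div_right_comm]
    gcongr
    rw [le_div_iff₀ (by positivity)]
    exact hsum.le_tsum j fun i _ => by positivity
  · refine (intervalIntegral.norm_integral_le_of_norm_le_const (C := S / R ^ (j + 1))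
      fun x hx => hqn x ?_).trans_eq ?_
    · rw [Set.uIoc_of_le hR.le] at hx
      exact ⟨hx.1.le, hx.2⟩
    · rw [sub_zero, abs_of_pos hR, pow_succ]
      field_simp

/-! ### The simple pole at `ω`, and the model functions `1` and `x`. -/

/-- The antiderivative `-log |ω - x|` of the pole takes equal values at `ω - ε` and `ω + ε`, so the
two divergences cancel. -/
theorem hasPVReal_of_eq_pole_add {h w : ℝ → ℂ} {κ : ℂ} {ω R : ℝ} (hω : 0 < ω) (hωR : ω < R)
    (hw : IntervalIntegrable w volume 0 R)
    (hh : ∀ x : ℝ, 0 ≤ x → x ≤ R → x ≠ ω → h x = κ * ((1 / (ω - x) : ℝ) : ℂ) + w x) :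
    HasPVReal h ω R (κ * ((Real.log ω - Real.log (R - ω) : ℝ) : ℂ) + ∫ x in (0 : ℝ)..R, w x) := by
  have hR := hω.trans hωR
  have hw' : ∀ s t : ℝ, 0 ≤ s → s ≤ t → t ≤ R → IntervalIntegrable w volume s t := by
    intro s t hs hst ht
    refine hw.mono_set ?_
    rw [Set.uIcc_of_le hst, Set.uIcc_of_le hR.le]
    exact Set.Icc_subset_Icc hs ht
  have hpole : ∀ s t : ℝ, s ≤ t → (∀ x, s ≤ x → x ≤ t → x ≠ ω) →
      IntervalIntegrable (fun x : ℝ => ((1 / (ω - x) : ℝ) : ℂ)) volume s t := by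
    intro s t hst hne
    refine intervalIntegrable_of_continuousAt hst fun x h0 h1 => ?_
    have : ω - x ≠ 0 := sub_ne_zero.2 (hne x h0 h1).symm
    exact Complex.continuous_ofReal.continuousAt.comp
      (ContinuousAt.div (by fun_prop) (by fun_prop) this)
  have key : ∀ s t : ℝ, 0 ≤ s → s ≤ t → t ≤ R → (∀ x, s ≤ x → x ≤ t → x ≠ ω) →
      IntervalIntegrable h volume s t ∧ ∫ x in s..t, h x
        = κ * ((Real.log (ω - s) - Real.log (ω - t) : ℝ) : ℂ) + ∫ x in s..t, w x := by
    intro s t hs hst ht hne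
    have hEq : Set.EqOn (fun x : ℝ => κ * ((1 / (ω - x) : ℝ) : ℂ) + w x) h (Set.uIoc s t) := by
      intro x hx
      rw [Set.uIoc_of_le hst] at hx
      exact (hh x (hs.trans hx.1.le) (hx.2.trans ht) (hne x hx.1.le hx.2)).symm
    have hi := ((hpole s t hst hne).const_mul κ).add (hw' s t hs hst ht)
    refine ⟨hi.congr hEq, ?_⟩
    rw [← intervalIntegral.integral_congr_ae (Eventually.of_forall hEq),
      intervalIntegral.integral_add ((hpole s t hst hne).const_mul κ) (hw' s t hs hst ht),
      intervalIntegral.integral_const_mul]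
    congr 2
    rw [intervalIntegral.integral_eq_sub_of_hasDerivAt
      (f := fun x : ℝ => ((-Real.log (ω - x) : ℝ) : ℂ)) (fun x hx => ?_) (hpole s t hst hne)]
    · push_cast
      ring
    · rw [Set.uIcc_of_le hst] at hx
      have hne' : ω - x ≠ 0 := sub_ne_zero.2 (hne x hx.1 hx.2).symm
      refine ((((hasDerivAt_id x).const_sub ω).log hne').neg.congr_deriv ?_).ofReal_comp
      rw [neg_div, neg_neg]
      rfl
  have hsmall : ∀ᶠ ε in 𝓝[>] (0 : ℝ), 0 < ε ∧ ε < ω ∧ ε < R - ω := by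
    filter_upwards [Ioo_mem_nhdsGT (lt_min hω (sub_pos.2 hωR))] with ε hε
    exact ⟨hε.1, hε.2.trans_le (min_le_left _ _), hε.2.trans_le (min_le_right _ _)⟩
  have hL : ∀ ε, 0 < ε ∧ ε < ω ∧ ε < R - ω → _ := fun ε hε => key 0 (ω - ε) le_rfl
    (by linarith) (by linarith) (fun x _ h1 => by intro h; linarith)
  have hRt : ∀ ε, 0 < ε ∧ ε < ω ∧ ε < R - ω → _ := fun ε hε => key (ω + ε) R
    (by linarith) (by linarith) le_rfl (fun x h1 _ => by intro h; linarith)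
  refine ⟨hω, hωR, ?_, ?_⟩
  · filter_upwards [hsmall] with ε hε
    exact ⟨(hL ε hε).1, (hRt ε hε).1⟩
  · have hc := intervalIntegral.continuousOn_primitive_interval' (a := 0) hw Set.left_mem_uIcc
    rw [Set.uIcc_of_le hR.le] at hc
    have hcω : ContinuousAt (fun b => ∫ x in (0 : ℝ)..b, w x) ω :=
      hc.continuousAt (Icc_mem_nhds hω hωR)
    have hlim : Tendsto (fun ε : ℝ => κ * ((Real.log ω - Real.log (R - ω) : ℝ) : ℂ)
        + ((∫ x in (0 : ℝ)..R, w x) + ((∫ x in (0 : ℝ)..(ω - ε), w x)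
          - ∫ x in (0 : ℝ)..(ω + ε), w x))) (𝓝[>] 0)
        (𝓝 (κ * ((Real.log ω - Real.log (R - ω) : ℝ) : ℂ)
        + ((∫ x in (0 : ℝ)..R, w x) + ((∫ x in (0 : ℝ)..ω, w x)
          - ∫ x in (0 : ℝ)..ω, w x)))) := by
      have t1 : Tendsto (fun ε : ℝ => ω - ε) (𝓝[>] 0) (𝓝 ω) := by
        have : Tendsto (fun ε : ℝ => ω - ε) (𝓝 0) (𝓝 (ω - 0)) :=
          (continuous_const.sub continuous_id).tendsto 0
        rw [sub_zero] at this
        exact this.mono_left nhdsWithin_le_nhds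
      have t2 : Tendsto (fun ε : ℝ => ω + ε) (𝓝[>] 0) (𝓝 ω) := by
        have : Tendsto (fun ε : ℝ => ω + ε) (𝓝 0) (𝓝 (ω + 0)) :=
          (continuous_const.add continuous_id).tendsto 0
        rw [add_zero] at this
        exact this.mono_left nhdsWithin_le_nhds
      exact tendsto_const_nhds.add (tendsto_const_nhds.add
        ((hcω.tendsto.comp t1).sub (hcω.tendsto.comp t2)))
    rw [sub_self, add_zero] at hlim
    refine hlim.congr' ?_
    filter_upwards [hsmall] with ε hε
    rw [(hL ε hε).2, (hRt ε hε).2, ← intervalIntegral.integral_add_adjacent_intervals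
      (hw' 0 (ω + ε) le_rfl (by linarith) (by linarith))
      (hw' (ω + ε) R (by linarith) (by linarith) le_rfl)]
    -- `Real.log` is even, so one antiderivative works on both sides of the pole.
    rw [show ω - (ω + ε) = -ε by ring, show ω - (ω - ε) = ε by ring, Real.log_neg_eq_log,
      sub_zero, show ω - R = -(R - ω) by ring, Real.log_neg_eq_log]
    push_cast
    ring

/-- Newton interpolation at `ω` and `-ω`; divided differences stay holomorphic by removability of
singularities. -/
theorem exists_eq_linear_add_mul {f : ℂ → ℂ} {ω ρ : ℝ} (hω : 0 < ω) (hωρ : ω < ρ)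
    (hf : DifferentiableOn ℂ f (Metric.ball 0 ρ)) :
    ∃ g : ℂ → ℂ, DifferentiableOn ℂ g (Metric.ball 0 ρ) ∧ ∀ z : ℂ, f z =
      (f ω + f (-(ω : ℂ))) / 2 + (f ω - f (-(ω : ℂ))) / (2 * ω) * z
        + ((ω : ℂ) ^ 2 - z ^ 2) * g z := by
  have h1 : Metric.ball (0 : ℂ) ρ ∈ 𝓝 (ω : ℂ) := Metric.isOpen_ball.mem_nhds (by
    rwa [mem_ball_zero_iff, Complex.norm_real, Real.norm_of_nonneg hω.le])
  have h2 : Metric.ball (0 : ℂ) ρ ∈ 𝓝 (-(ω : ℂ)) := Metric.isOpen_ball.mem_nhds (by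
    rwa [mem_ball_zero_iff, norm_neg, Complex.norm_real, Real.norm_of_nonneg hω.le])
  refine ⟨fun z => -dslope (dslope f ω) (-(ω : ℂ)) z, ((Complex.differentiableOn_dslope h2).2
    ((Complex.differentiableOn_dslope h1).2 hf)).neg, fun z => ?_⟩
  have hω' : (ω : ℂ) ≠ 0 := by exact_mod_cast hω.ne'
  have e1 := sub_smul_dslope f (ω : ℂ) z
  have e2 := sub_smul_dslope f (ω : ℂ) (-(ω : ℂ))
  have e3 := sub_smul_dslope (dslope f ω) (-(ω : ℂ)) z
  simp only [smul_eq_mul] at e1 e2 e3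
  have e4 : dslope f ω (-(ω : ℂ)) = (f ω - f (-(ω : ℂ))) / (2 * ω) := by
    rw [eq_div_iff (by simpa using hω')]
    linear_combination -e2
  rw [e4] at e3
  have e5 : (f ω - f (-(ω : ℂ))) / (2 * ω) * ω = (f ω - f (-(ω : ℂ))) / 2 := by
    field_simp
  linear_combination -e1 - (z - ω) * e3 - e5

theorem hasFinitePartReal_one_div_pow {R : ℝ} (hR : 0 < R) (k : ℕ) :
    HasFinitePartReal (fun x : ℝ => 1 / (x : ℂ) ^ (2 * k + 1)) R
      (if k = 0 then (Real.log R : ℂ) else -(1 / ((2 * k : ℂ) * (R : ℂ) ^ (2 * k)))) := by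
  split_ifs with hk
  · subst hk
    simpa using hasFinitePartReal_pow_div_pow_succ hR 0
  · simpa using hasFinitePartReal_pow_div_pow hR (n := 0) (j := 2 * k) (by omega)

theorem hasFinitePartReal_id_div_pow {R : ℝ} (hR : 0 < R) (k : ℕ) :
    HasFinitePartReal (fun x : ℝ => (x : ℂ) / (x : ℂ) ^ (2 * k + 1)) R
      (-((R : ℂ) / ((2 * k - 1 : ℂ) * (R : ℂ) ^ (2 * k)))) := by
  have hR' : (R : ℂ) ≠ 0 := by exact_mod_cast hR.ne'
  rcases k with _ | k
  -- For `k = 0` the integrand is `1`, and since `2k - 1 = -1` in `ℂ` the general formula still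
  -- gives `R`.
  · have h := HasFinitePartReal.of_integrable hR
      (intervalIntegrable_const (c := (1 : ℂ)) (μ := volume))
    have h' := h.congr (h' := fun x : ℝ => (x : ℂ) / (x : ℂ) ^ (2 * 0 + 1)) fun x h0 _ => by
      have : (x : ℂ) ≠ 0 := by exact_mod_cast h0.ne'
      simp [this]
    convert h' using 1
    simp [div_neg]
  · have h := hasFinitePartReal_pow_div_pow hR (n := 1) (j := 2 * (k + 1)) (by omega)
    rw [show 2 * (k + 1) - 1 = 2 * k + 1 by omega] at h
    simp only [pow_one] at h
    convert h using 2
    rw [show 2 * (k + 1) = 2 * k + 1 + 1 by ring, pow_succ (R : ℂ) (2 * k + 1)]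
    push_cast
    rw [show (2 * ((k : ℂ) + 1) - 1) = 2 * k + 1 by ring, ← mul_assoc,
      div_mul_cancel_right₀ hR', one_div]

/-- The terms with `k ≥ 1` form the Taylor series of `log (1 - q²) / 2` at `q = ω / R`. -/
theorem hasSum_finitePart_one {ω R : ℝ} (hω : 0 < ω) (hωR : ω < R) :
    HasSum (fun k : ℕ => (ω : ℂ) ^ (2 * k) *
      (if k = 0 then (Real.log R : ℂ) else -(1 / ((2 * k : ℂ) * (R : ℂ) ^ (2 * k)))))
      (Real.log R + 1 / 2 * (Real.log (1 + ω / R) + Real.log (1 - ω / R) : ℝ)) := by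
  have hR := hω.trans hωR
  have h1 : ω / R < 1 := (div_lt_one hR).2 hωR
  have h0 : 0 < ω / R := div_pos hω hR
  have hq : |(ω / R) ^ 2| < 1 := by
    rw [abs_of_nonneg (by positivity)]
    exact pow_lt_one₀ h0.le h1 two_ne_zero
  have hs := (Complex.hasSum_ofReal.2 (Real.hasSum_pow_div_log_of_abs_lt_one hq)).mul_left (-1 / 2)
  have hR' : (R : ℂ) ≠ 0 := by exact_mod_cast hR.ne'
  refine (hasSum_nat_add_iff' 1).1 ?_
  have hv : ((-1 / 2 : ℂ)) * ((-Real.log (1 - (ω / R) ^ 2) : ℝ) : ℂ)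
      = (Real.log R + 1 / 2 * (Real.log (1 + ω / R) + Real.log (1 - ω / R) : ℝ))
        - ∑ i ∈ Finset.range 1, (ω : ℂ) ^ (2 * i) *
      (if i = 0 then (Real.log R : ℂ) else -(1 / ((2 * i : ℂ) * (R : ℂ) ^ (2 * i)))) := by
    rw [← Real.log_mul (by positivity) (by linarith), Finset.sum_range_one, if_pos rfl,
      show 1 - (ω / R) ^ 2 = (1 + ω / R) * (1 - ω / R) by ring]
    push_cast
    ring
  rw [← hv]
  refine hs.congr_fun fun k => ?_
  have hk : (k : ℂ) + 1 ≠ 0 := by exact_mod_cast k.succ_ne_zero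
  rw [if_neg k.succ_ne_zero, ← pow_mul]
  push_cast
  rw [div_pow, show 2 * (k + 1) = 2 + 2 * k by ring]
  field_simp

/-- The terms with `k ≥ 1` form the odd series of `log (1 + q) - log (1 - q)` at `q = ω / R`. -/
theorem hasSum_finitePart_id {ω R : ℝ} (hω : 0 < ω) (hωR : ω < R) :
    HasSum (fun k : ℕ => (ω : ℂ) ^ (2 * k) *
      (-((R : ℂ) / ((2 * k - 1 : ℂ) * (R : ℂ) ^ (2 * k)))))
      (R - ω / 2 * (Real.log (1 + ω / R) - Real.log (1 - ω / R) : ℝ)) := by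
  have hR := hω.trans hωR
  have hq : |ω / R| < 1 := by
    rw [abs_of_pos (div_pos hω hR)]
    exact (div_lt_one hR).2 hωR
  have hs := (Complex.hasSum_ofReal.2
    (Real.hasSum_log_sub_log_of_abs_lt_one hq)).mul_left (-(ω : ℂ) / 2)
  have hR' : (R : ℂ) ≠ 0 := by exact_mod_cast hR.ne'
  refine (hasSum_nat_add_iff' 1).1 ?_
  have hv : (-(ω : ℂ) / 2) * ((Real.log (1 + ω / R) - Real.log (1 - ω / R) : ℝ) : ℂ)
      = (R - ω / 2 * (Real.log (1 + ω / R) - Real.log (1 - ω / R) : ℝ))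
        - ∑ i ∈ Finset.range 1, (ω : ℂ) ^ (2 * i) *
      (-((R : ℂ) / ((2 * i - 1 : ℂ) * (R : ℂ) ^ (2 * i)))) := by
    rw [Finset.sum_range_one]
    simp
    ring
  rw [← hv]
  refine hs.congr_fun fun k => ?_
  have hk : 2 * (k : ℂ) + 1 ≠ 0 := by exact_mod_cast (2 * k).succ_ne_zero
  push_cast
  rw [div_pow, show 2 * (k + 1) = 1 + (2 * k + 1) by ring,
    show 2 * ((k : ℂ) + 1) - 1 = 2 * k + 1 by ring, pow_add _ 1, pow_add _ 1, pow_one, pow_one]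
  field_simp

/-! ### The interval `[0, R]`. -/

/-- The expansion on an interval `[0, R]` inside the disc of analyticity. -/
theorem exists_hasPVReal_hasSum {f : ℂ → ℂ} {ω R ρ : ℝ} (hω : 0 < ω) (hωR : ω < R) (hRρ : R < ρ)
    (hf : DifferentiableOn ℂ f (Metric.ball 0 ρ)) :
    ∃ (V : ℂ) (F : ℕ → ℂ),
      HasPVReal (fun x : ℝ => (x : ℂ) * f x / ((ω : ℂ) ^ 2 - (x : ℂ) ^ 2)) ω R V ∧
      (∀ k : ℕ, HasFinitePartReal (fun x : ℝ => f x / (x : ℂ) ^ (2 * k + 1)) R (F k)) ∧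
      HasSum (fun k : ℕ => (ω : ℂ) ^ (2 * k) * F k)
        (1 / 2 * (f ω + f (-(ω : ℂ))) * (Real.log ω : ℂ) - V) := by
  have hR := hω.trans hωR
  obtain ⟨g, hg, hfg⟩ := exists_eq_linear_add_mul hω (hωR.trans hRρ) hf
  set α := (f ω + f (-(ω : ℂ))) / 2 with hα
  set β := (f ω - f (-(ω : ℂ))) / (2 * ω) with hβ
  -- With `φ = z² g`, the finite part of `(ω² - x²) g / x^(2k+1)` is `ω² D (k + 1) - D k`, and `D 0`
  -- is the ordinary integral of `x g`.
  obtain ⟨C, hC⟩ := exists_hasFinitePartReal_div_pow hR hRρ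
    (φ := fun z => z ^ 2 * g z) ((differentiableOn_id.pow 2).mul hg)
  choose D hD hDC using fun k : ℕ => hC (2 * k)
  have hgc : ContinuousOn (fun x : ℝ => (x : ℂ) * g x) (Set.Icc 0 R) := by
    refine Complex.continuous_ofReal.continuousOn.mul
      (hg.continuousOn.comp Complex.continuous_ofReal.continuousOn fun x hx => ?_)
    rw [mem_ball_zero_iff, Complex.norm_real, Real.norm_of_nonneg hx.1]
    exact hx.2.trans_lt hRρ
  have hgi : IntervalIntegrable (fun x : ℝ => (x : ℂ) * g x) volume 0 R :=
    hgc.intervalIntegrable_of_Icc hR.le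
  have hD0 : D 0 = ∫ x in (0 : ℝ)..R, (x : ℂ) * g x := by
    refine (hD 0).unique ((HasFinitePartReal.of_integrable hR hgi).congr fun x h0 _ => ?_)
    have : (x : ℂ) ≠ 0 := by exact_mod_cast h0.ne'
    field_simp
    simp [mul_comm]
  have hli : IntervalIntegrable (fun x : ℝ => ((1 / (ω + x) : ℝ) : ℂ)) volume 0 R := by
    refine intervalIntegrable_of_continuousAt hR.le fun x h0 _ => ?_
    have : ω + x ≠ 0 := by positivity
    exact Complex.continuous_ofReal.continuousAt.comp
      (ContinuousAt.div (by fun_prop) (by fun_prop) this)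
  have hlog : ∫ x in (0 : ℝ)..R, ((1 / (ω + x) : ℝ) : ℂ)
      = ((Real.log (ω + R) - Real.log ω : ℝ) : ℂ) := by
    rw [intervalIntegral.integral_eq_sub_of_hasDerivAt
      (f := fun x : ℝ => ((Real.log (ω + x) : ℝ) : ℂ)) (fun x hx => ?_) hli]
    · simp
    · rw [Set.uIcc_of_le hR.le] at hx
      have hx0 := hx.1
      have hne : ω + x ≠ 0 := by positivity
      exact (((hasDerivAt_id x).const_add ω).log hne).ofReal_comp
  -- Partial fractions of `x (α + β x) / (ω² - x²)`: the constant `-β`, a harmless pole at `-ω`, and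
  -- `κ / (ω - x)` with `κ = (α + β ω) / 2`.
  have hwi := ((intervalIntegrable_const (c := -β) (μ := volume) (a := (0 : ℝ)) (b := R)).add
    (hli.const_mul ((β * ω - α) / 2))).add hgi
  have hV := hasPVReal_of_eq_pole_add
    (h := fun x : ℝ => (x : ℂ) * f x / ((ω : ℂ) ^ 2 - (x : ℂ) ^ 2)) (κ := (α + β * ω) / 2)
    hω hωR hwi (fun x h0 _ hne => by
      have n1 : (ω : ℂ) - x ≠ 0 := sub_ne_zero.2 (by exact_mod_cast hne.symm)
      have n2 : (ω : ℂ) + x ≠ 0 := by exact_mod_cast (show ω + x ≠ 0 by positivity)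
      have n3 : (ω : ℂ) ^ 2 - (x : ℂ) ^ 2 ≠ 0 := by
        rw [sq_sub_sq]
        exact mul_ne_zero n2 n1
      have hfx := hfg x
      rw [hfx]
      push_cast
      rw [div_eq_iff n3]
      have i1 : 1 / ((ω : ℂ) - x) * ((ω : ℂ) ^ 2 - (x : ℂ) ^ 2) = ω + x := by
        field_simp
        ring
      have i2 : 1 / ((ω : ℂ) + x) * ((ω : ℂ) ^ 2 - (x : ℂ) ^ 2) = ω - x := by
        field_simp
        ring
      linear_combination (-(α + β * ω) / 2) * i1 - (β * ω - α) / 2 * i2)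
  refine ⟨_, _, hV, fun k => ((((hasFinitePartReal_one_div_pow hR k).const_mul α).add
    ((hasFinitePartReal_id_div_pow hR k).const_mul β)).add
    (((hD (k + 1)).const_mul ((ω : ℂ) ^ 2)).add ((hD k).const_mul (-1)))).congr
      fun x h0 _ => ?_, ?_⟩
  · have hx : (x : ℂ) ≠ 0 := by exact_mod_cast h0.ne'
    rw [hfg x, show 2 * (k + 1) + 1 = 2 * k + 1 + 2 by ring, pow_add]
    field_simp
    ring
  · refine ((((hasSum_finitePart_one hω hωR).mul_left α).add
      ((hasSum_finitePart_id hω hωR).mul_left β)).add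
      (hasSum_telescope hω hωR hDC)).congr_fun (fun k => ?_) |>.trans_eq ?_
    · ring
    · rw [intervalIntegral.integral_add ((intervalIntegrable_const).add (hli.const_mul _)) hgi,
        intervalIntegral.integral_add intervalIntegrable_const (hli.const_mul _),
        intervalIntegral.integral_const_mul, hlog, ← hD0]
      have hω1 : ω / R < 1 := (div_lt_one hR).2 hωR
      have l1 : Real.log (ω + R) = Real.log (1 + ω / R) + Real.log R := by
        rw [← Real.log_mul (by positivity) hR.ne']
        congr 1
        field_simp
        ring
      have l2 : Real.log (R - ω) = Real.log (1 - ω / R) + Real.log R := by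
        rw [← Real.log_mul (by linarith) hR.ne']
        congr 1
        field_simp
      have hfα : f ω + f (-(ω : ℂ)) = 2 * α := by rw [hα]; ring
      rw [hfα, l1, l2]
      simp
      ring

/-! ### The tail `[R, a]`. -/

theorem UpTo.unique {P : ℝ → ℂ → Prop} (hP : ∀ A v w, P A v → P A w → v = w) {a : WithTop ℝ}
    {L M : ℂ} (hL : UpTo P a L) (hM : UpTo P a M) : L = M := by
  cases a with
  | coe A => exact hP A L M hL hM
  | top =>
    obtain ⟨x, hx, hx'⟩ := hL
    obtain ⟨y, hy, hy'⟩ := hM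
    refine tendsto_nhds_unique hx' (hy'.congr' ?_)
    filter_upwards [hx, hy] with A h1 h2
    exact hP A _ _ h2 h1

theorem HasTailIntegral.unique {h : ℝ → ℂ} {R : ℝ} {a : WithTop ℝ} {L M : ℂ}
    (hL : HasTailIntegral h R a L) (hM : HasTailIntegral h R a M) : L = M :=
  UpTo.unique (fun _ _ _ hv hw => hv.2.symm.trans hw.2) hL hM

theorem hasTailIntegral_top {h : ℝ → ℂ} {R : ℝ} {L : ℂ} (hc : ∀ x, R ≤ x → ContinuousAt h x)
    (hL : Tendsto (fun A : ℝ => ∫ x in R..A, h x) atTop (𝓝 L)) : HasTailIntegral h R ⊤ L := by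
  refine ⟨_, ?_, hL⟩
  filter_upwards [eventually_ge_atTop R] with A hA
  exact ⟨intervalIntegrable_of_continuousAt hA fun x hx _ => hc x hx, rfl⟩

theorem HasTailIntegral.tendsto {h : ℝ → ℂ} {R : ℝ} {L : ℂ} (hL : HasTailIntegral h R ⊤ L) :
    Tendsto (fun A : ℝ => ∫ x in R..A, h x) atTop (𝓝 L) := by
  obtain ⟨v, hv, hv'⟩ := hL
  exact hv'.congr' (hv.mono fun A hA => hA.2.symm)

/-- Dirichlet's test for improper integrals, with a bound. -/
theorem exists_tendsto_integral_mul {h : ℝ → ℂ} {R : ℝ} {L : ℂ}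
    (hc : ∀ x, R ≤ x → ContinuousAt h x)
    (hL : Tendsto (fun A : ℝ => ∫ x in R..A, h x) atTop (𝓝 L)) :
    ∃ M : ℝ, ∀ (φ φ' : ℝ → ℝ) (l : ℝ), (∀ x ∈ Set.Ici R, HasDerivAt φ (φ' x) x) →
      ContinuousOn φ' (Set.Ici R) → (∀ x ∈ Set.Ici R, φ' x ≤ 0) → (∀ x ∈ Set.Ici R, 0 ≤ φ x) →
      Tendsto φ atTop (𝓝 l) →
      ∃ L' : ℂ, Tendsto (fun A : ℝ => ∫ x in R..A, (φ x : ℂ) * h x) atTop (𝓝 L') ∧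
        ‖L'‖ ≤ M * φ R := by
  set H : ℝ → ℂ := fun A => ∫ x in R..A, h x
  have hi : ∀ A, R ≤ A → IntervalIntegrable h volume R A := fun A hA =>
    intervalIntegrable_of_continuousAt hA fun x hx _ => hc x hx
  have hHc : ∀ A, R ≤ A → ContinuousOn H (Set.Icc R A) := fun A hA => by
    rw [← Set.uIcc_of_le hA]
    exact intervalIntegral.continuousOn_primitive_interval' (hi A hA) Set.left_mem_uIcc
  have hHc' : ContinuousOn H (Set.Ici R) := by
    intro x hx
    have hx1 : R ≤ x := hx
    refine (hHc (x + 1) (by linarith) x ⟨hx1, by linarith⟩).mono_of_mem_nhdsWithin ?_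
    rw [← Set.Ici_inter_Iic]
    exact inter_mem_nhdsWithin _ (Iic_mem_nhds (by linarith))
  have hHd : ∀ x, R < x → HasDerivAt H (h x) x := fun x hx =>
    intervalIntegral.integral_hasDerivAt_right (hi x hx.le)
      (ContinuousOn.stronglyMeasurableAtFilter isOpen_Ioi
        (fun y hy => (hc y (le_of_lt hy)).continuousWithinAt) x hx) (hc x hx.le)
  obtain ⟨M, hM⟩ : ∃ M : ℝ, ∀ A, R ≤ A → ‖H A‖ ≤ M := by
    obtain ⟨B, hB⟩ := eventually_atTop.1
      (hL.norm.eventually (eventually_le_nhds (lt_add_one ‖L‖)))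
    obtain ⟨K, hK⟩ := isCompact_Icc.exists_bound_of_continuousOn
      (hHc (max R B) (le_max_left _ _))
    refine ⟨max K (‖L‖ + 1), fun A hA => ?_⟩
    rcases le_total A (max R B) with h1 | h1
    · exact (hK A ⟨hA, h1⟩).trans (le_max_left _ _)
    · exact (hB A ((le_max_right _ _).trans h1)).trans (le_max_right _ _)
  refine ⟨M, fun φ φ' l hφ hφ'c hφ'0 hφ0 hl => ?_⟩
  have hφi : ∀ A, R ≤ A → IntervalIntegrable φ' volume R A := fun A hA =>
    (hφ'c.mono Set.Icc_subset_Ici_self).intervalIntegrable_of_Icc hA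
  -- Integration by parts moves the derivative to `φ`, whose total variation is finite by
  -- monotonicity.
  have hparts : ∀ A, R ≤ A → ∫ x in R..A, (φ x : ℂ) * h x
      = (φ A : ℂ) * H A - ∫ x in R..A, (φ' x : ℂ) * H x := by
    intro A hA
    have hφ'i : IntervalIntegrable (fun x => (φ' x : ℂ)) volume R A :=
      (Complex.continuous_ofReal.comp_continuousOn
        (hφ'c.mono Set.Icc_subset_Ici_self)).intervalIntegrable_of_Icc hA
    have hφc : ContinuousOn (fun x => (φ x : ℂ)) (Set.uIcc R A) := by
      rw [Set.uIcc_of_le hA]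
      exact Complex.continuous_ofReal.comp_continuousOn
        fun x hx => (hφ x hx.1).continuousAt.continuousWithinAt
    have hHc₁ : ContinuousOn H (Set.uIcc R A) := by
      rw [Set.uIcc_of_le hA]
      exact hHc A hA
    have h1 := intervalIntegral.integral_deriv_mul_eq_sub_of_hasDerivAt hφc hHc₁
      (fun x hx => (hφ x (by rw [min_eq_left hA] at hx; exact hx.1.le)).ofReal_comp)
      (fun x hx => hHd x (by rw [min_eq_left hA] at hx; exact hx.1)) hφ'i (hi A hA)
    rw [intervalIntegral.integral_add (hφ'i.mul_continuousOn hHc₁)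
      ((hi A hA).continuousOn_mul hφc)] at h1
    rw [eq_sub_iff_add_eq, add_comm, h1]
    simp [H]
  have hint : IntegrableOn (fun x => (φ' x : ℂ) * H x) (Set.Ioi R) := by
    have h1 := integrableOn_Ioi_deriv_of_nonpos' hφ (fun x hx => hφ'0 x (Set.Ioi_subset_Ici_self hx)) hl
    refine Integrable.mul_bdd (c := M) h1.ofReal
      ((hHc'.mono Set.Ioi_subset_Ici_self).aestronglyMeasurable measurableSet_Ioi) ?_
    exact (ae_restrict_iff' measurableSet_Ioi).2
      (Eventually.of_forall fun x hx => hM x (le_of_lt hx))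
  have hlim := ((Complex.continuous_ofReal.tendsto l).comp hl).mul hL |>.sub
    (intervalIntegral_tendsto_integral_Ioi R hint tendsto_id)
  have hlim' := hlim.congr' (f₂ := fun A : ℝ => ∫ x in R..A, (φ x : ℂ) * h x) (by
    filter_upwards [eventually_ge_atTop R] with A hA
    exact (hparts A hA).symm)
  refine ⟨_, hlim', le_of_tendsto hlim'.norm ?_⟩
  filter_upwards [eventually_ge_atTop R] with A hA
  rw [hparts A hA]
  have b1 : ‖(φ A : ℂ) * H A‖ ≤ φ A * M := by
    rw [norm_mul, Complex.norm_real, Real.norm_of_nonneg (hφ0 A hA)]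
    exact mul_le_mul_of_nonneg_left (hM A hA) (hφ0 A hA)
  -- The right side is `M (φ R - φ A)`; added to `M φ A` it leaves exactly `M φ R`.
  have b2 : ‖∫ x in R..A, (φ' x : ℂ) * H x‖ ≤ ∫ x in R..A, -φ' x * M := by
    refine intervalIntegral.norm_integral_le_of_norm_le hA (Eventually.of_forall fun x hx => ?_)
      ((hφi A hA).neg.mul_const M)
    rw [norm_mul, Complex.norm_real, Real.norm_of_nonpos (hφ'0 x hx.1.le)]
    exact mul_le_mul_of_nonneg_left (hM x hx.1.le) (neg_nonneg.2 (hφ'0 x hx.1.le))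
  rw [intervalIntegral.integral_mul_const, intervalIntegral.integral_neg,
    intervalIntegral.integral_eq_sub_of_hasDerivAt (fun x hx => hφ x (by
      rw [Set.uIcc_of_le hA] at hx; exact hx.1)) (hφi A hA)] at b2
  refine (norm_sub_le _ _).trans ((add_le_add b1 b2).trans_eq ?_)
  ring

/-- For finite `a` the bound is the `L¹` norm of `u` times the maximum of `x^(-2N)`; for `a = ∞` it
is Dirichlet's test with the weight `x^(-2N)`, where `M` must not depend on `N`. -/
theorem HasTailIntegral.exists_div_pow {u : ℝ → ℂ} {R : ℝ} {a : WithTop ℝ} {U : ℂ} (hR : 0 < R)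
    (hRa : (R : WithTop ℝ) < a) (hc : ∀ x : ℝ, R ≤ x → (x : WithTop ℝ) ≤ a → ContinuousAt u x)
    (hU : HasTailIntegral u R a U) :
    ∃ M : ℝ, ∀ N : ℕ, ∃ D : ℂ,
      HasTailIntegral (fun x : ℝ => u x / (x : ℂ) ^ (2 * N)) R a D ∧ ‖D‖ ≤ M / R ^ (2 * N) := by
  have hc' : ∀ N : ℕ, ∀ x : ℝ, R ≤ x → (x : WithTop ℝ) ≤ a →
      ContinuousAt (fun x : ℝ => u x / (x : ℂ) ^ (2 * N)) x := fun N x hx hxa => by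
    have : (x : ℂ) ≠ 0 := by exact_mod_cast (hR.trans_le hx).ne'
    exact (hc x hx hxa).div (by fun_prop) (pow_ne_zero _ this)
  cases a with
  | coe A =>
    have hRA : R < A := WithTop.coe_lt_coe.1 hRa
    refine ⟨∫ x in R..A, ‖u x‖, fun N => ⟨_, ⟨intervalIntegrable_of_continuousAt hRA.le
      fun x hx hxA => hc' N x hx (WithTop.coe_le_coe.2 hxA), rfl⟩, ?_⟩⟩
    rw [← intervalIntegral.integral_div]
    refine intervalIntegral.norm_integral_le_of_norm_le hRA.le
      (Eventually.of_forall fun x hx => ?_) ((hU.1.norm).div_const _)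
    rw [norm_div, norm_pow, Complex.norm_real, Real.norm_of_nonneg (hR.trans hx.1).le]
    have := hx.1.le
    gcongr
  | top =>
    obtain ⟨M, hM⟩ := exists_tendsto_integral_mul (fun x hx => hc x hx le_top) hU.tendsto
    refine ⟨M, fun N => ?_⟩
    obtain ⟨l, hl⟩ : ∃ l : ℝ, Tendsto (fun x : ℝ => (x ^ (2 * N))⁻¹) atTop (𝓝 l) := by
      rcases N with _ | N
      · exact ⟨1, by simp⟩
      · exact ⟨0, tendsto_inv_atTop_zero.comp (tendsto_pow_atTop (by omega))⟩
    have hpos : ∀ x ∈ Set.Ici R, 0 < x := fun x hx => hR.trans_le hx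
    obtain ⟨D, hD, hDM⟩ := hM (fun x => (x ^ (2 * N))⁻¹)
      -- At `N = 0` the truncated exponent `2 * N - 1` is harmless: the factor `2 * N` vanishes.
      (fun x => -((2 * N : ℕ) * x ^ (2 * N - 1)) / (x ^ (2 * N)) ^ 2) l
      (fun x hx => (hasDerivAt_pow (2 * N) x).inv (pow_ne_zero _ (hpos x hx).ne'))
      (ContinuousOn.div (by fun_prop) (by fun_prop) fun x hx =>
        pow_ne_zero _ (pow_ne_zero _ (hpos x hx).ne'))
      (fun x hx => by
        have := hpos x hx
        rw [neg_div]
        exact neg_nonpos.2 (by positivity))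
      (fun x hx => by
        have := hpos x hx
        positivity) hl
    refine ⟨D, hasTailIntegral_top (fun x hx => hc' N x hx le_top) (hD.congr fun A => ?_), hDM⟩
    refine intervalIntegral.integral_congr fun x _ => ?_
    simp only [div_eq_mul_inv]
    push_cast
    ring

theorem continuousAt_mul_div_sub {f : ℂ → ℂ} {ω x : ℝ} (hω : 0 < ω) (hx : ω < x)
    (hf : AnalyticAt ℂ f (x : ℂ)) :
    ContinuousAt (fun x : ℝ => (x : ℂ) * f x / ((ω : ℂ) ^ 2 - (x : ℂ) ^ 2)) x := by
  have hne : (ω : ℂ) ^ 2 - (x : ℂ) ^ 2 ≠ 0 := by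
    have : ω ^ 2 - x ^ 2 ≠ 0 := by nlinarith
    exact_mod_cast this
  have h1 : ContinuousAt (fun x : ℝ => f x) x :=
    ContinuousAt.comp (f := fun x : ℝ => (x : ℂ)) hf.continuousAt
      Complex.continuous_ofReal.continuousAt
  exact ContinuousAt.div (by fun_prop) (by fun_prop) hne

/-- The expansion on `[R, a]` with `R > ω`. -/
theorem HasTailIntegral.exists_hasSum {f : ℂ → ℂ} {ω R : ℝ} {a : WithTop ℝ} {U : ℂ} (hω : 0 < ω)
    (hωR : ω < R) (hRa : (R : WithTop ℝ) < a) (hf : ComplexAnalyticOn f a)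
    (hU : HasTailIntegral
      (fun x : ℝ => (x : ℂ) * f x / ((ω : ℂ) ^ 2 - (x : ℂ) ^ 2)) R a U) :
    ∃ T : ℕ → ℂ,
      (∀ k : ℕ, HasTailIntegral (fun x : ℝ => f x / (x : ℂ) ^ (2 * k + 1)) R a (T k)) ∧
      HasSum (fun k : ℕ => (ω : ℂ) ^ (2 * k) * T k) (-U) := by
  have hR := hω.trans hωR
  obtain ⟨M, hM⟩ := hU.exists_div_pow hR hRa fun x hx hxa =>
    continuousAt_mul_div_sub hω (hωR.trans_le hx) (hf x (hR.le.trans hx) hxa)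
  choose D hD hDM using hM
  have hD0 : D 0 = U := (hD 0).unique (by simpa using hU)
  refine ⟨fun k => (ω : ℂ) ^ 2 * D (k + 1) - D k, fun k => ?_, ?_⟩
  -- `R < A` is carried along because the pointwise identity needs `x > R > ω` on the interval.
  · refine UpTo.map₂ (P := fun A v => R < A ∧ _) (Q := fun A v => R < A ∧ _) ((ω : ℂ) ^ 2)
      (fun A v w _ hv hw => ?_)
      (UpTo.map continuous_id hRa (fun A v _ hA h => ⟨hA, h⟩) (hD (k + 1)))
      (UpTo.map continuous_id hRa (fun A v _ hA h => ⟨hA, h⟩) (hD k))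
    obtain ⟨hA, hv1, hv2⟩ := hv
    obtain ⟨-, hw1, hw2⟩ := hw
    have hEq : Set.EqOn (fun x : ℝ => (ω : ℂ) ^ 2 * ((x : ℂ) * f x / ((ω : ℂ) ^ 2 - (x : ℂ) ^ 2)
        / (x : ℂ) ^ (2 * (k + 1))) - (x : ℂ) * f x / ((ω : ℂ) ^ 2 - (x : ℂ) ^ 2)
        / (x : ℂ) ^ (2 * k)) (fun x : ℝ => f x / (x : ℂ) ^ (2 * k + 1)) (Set.uIoc R A) := by
      intro x hx
      rw [Set.uIoc_of_le hA.le] at hx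
      have hx0 : (x : ℂ) ≠ 0 := by exact_mod_cast (hR.trans hx.1).ne'
      have hne : (ω : ℂ) ^ 2 - (x : ℂ) ^ 2 ≠ 0 := by
        have : ω ^ 2 - x ^ 2 ≠ 0 := by nlinarith [hx.1]
        exact_mod_cast this
      simp only
      rw [show 2 * (k + 1) = 2 * k + 2 by ring, pow_add, pow_add]
      field_simp
    refine ⟨((hv1.const_mul _).sub hw1).congr hEq, ?_⟩
    rw [← intervalIntegral.integral_congr_ae (Eventually.of_forall hEq),
      intervalIntegral.integral_sub (hv1.const_mul _) hw1, intervalIntegral.integral_const_mul,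
      hv2, hw2]
  · rw [← hD0]
    exact hasSum_telescope hω hωR hDM

theorem exists_hasTailIntegral {f : ℂ → ℂ} {ω R : ℝ} {a : WithTop ℝ} {V : ℂ} (hω : 0 < ω)
    (hωR : ω < R) (hRa : (R : WithTop ℝ) < a) (hf : ComplexAnalyticOn f a)
    (hV : HasPVReal (fun x : ℝ => (x : ℂ) * f x / ((ω : ℂ) ^ 2 - (x : ℂ) ^ 2)) ω R V)
    (htop : a = ⊤ →
      (∃ L : ℂ, HasPV (fun x : ℝ => (x : ℂ) * f x / ((ω : ℂ) ^ 2 - (x : ℂ) ^ 2)) ω ⊤ L) ∨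
      (∃ L : ℂ, Tendsto (fun A : ℝ => ∫ x in (1 : ℝ)..A, f x / (x : ℂ)) atTop (𝓝 L))) :
    ∃ U : ℂ, HasTailIntegral
      (fun x : ℝ => (x : ℂ) * f x / ((ω : ℂ) ^ 2 - (x : ℂ) ^ 2)) R a U := by
  have hR := hω.trans hωR
  have hcu : ∀ x : ℝ, R ≤ x → (x : WithTop ℝ) ≤ a → ContinuousAt
      (fun x : ℝ => (x : ℂ) * f x / ((ω : ℂ) ^ 2 - (x : ℂ) ^ 2)) x := fun x hx hxa =>
    continuousAt_mul_div_sub hω (hωR.trans_le hx) (hf x (hR.le.trans hx) hxa)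
  cases a with
  | coe A =>
    have hRA : R < A := WithTop.coe_lt_coe.1 hRa
    exact ⟨_, intervalIntegrable_of_continuousAt hRA.le
      fun x hx hxA => hcu x hx (WithTop.coe_le_coe.2 hxA), rfl⟩
  | top =>
    rcases htop rfl with ⟨L, v, hv, hvL⟩ | ⟨L, hL⟩
    · refine ⟨L - V, hasTailIntegral_top (fun x hx => hcu x hx le_top)
        ((hvL.sub_const V).congr' ?_)⟩
      filter_upwards [hv, eventually_gt_atTop R] with A hA hRA
      have h1 := hV.extend hRA
        (intervalIntegrable_of_continuousAt hRA.le fun x hx _ => hcu x hx le_top) rfl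
      rw [tendsto_nhds_unique hA.2.2.2 h1.2.2.2]
      ring
    · have hcf : ∀ x : ℝ, 0 < x → ContinuousAt (fun x : ℝ => f x / (x : ℂ)) x := fun x hx => by
        have : (x : ℂ) ≠ 0 := by exact_mod_cast hx.ne'
        have h1 : ContinuousAt (fun x : ℝ => f x) x :=
          ContinuousAt.comp (f := fun x : ℝ => (x : ℂ)) (hf x hx.le le_top).continuousAt
            Complex.continuous_ofReal.continuousAt
        exact h1.div (by fun_prop) this
      have hif : ∀ s t : ℝ, 0 < s → 0 < t →
          IntervalIntegrable (fun x : ℝ => f x / (x : ℂ)) volume s t := fun s t hs ht =>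
        ContinuousOn.intervalIntegrable fun x hx =>
          (hcf x ((lt_min hs ht).trans_le hx.1)).continuousWithinAt
      have hLR : Tendsto (fun A : ℝ => ∫ x in R..A, f x / (x : ℂ)) atTop
          (𝓝 ((∫ x in R..(1 : ℝ), f x / (x : ℂ)) + L)) := by
        refine (hL.const_add _).congr' ?_
        filter_upwards [eventually_gt_atTop 0] with A hA
        exact intervalIntegral.integral_add_adjacent_intervals (hif _ _ hR one_pos)
          (hif _ _ one_pos hA)
      obtain ⟨M, hM⟩ := exists_tendsto_integral_mul (fun x hx => hcf x (hR.trans_le hx)) hLR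
      have hpos : ∀ x ∈ Set.Ici R, 0 < x ^ 2 - ω ^ 2 := fun x hx => by
        have hx' : R ≤ x := hx
        nlinarith
      have hlim : Tendsto (fun x : ℝ => 1 + ω ^ 2 * (x ^ 2 - ω ^ 2)⁻¹) atTop
          (𝓝 (1 + ω ^ 2 * 0)) := by
        refine (Tendsto.const_mul _ (tendsto_inv_atTop_zero.comp ?_)).const_add _
        exact tendsto_atTop_add_const_right _ _ (tendsto_pow_atTop two_ne_zero)
      -- The integrand is `-(f x / x)` times `x² / (x² - ω²)`, and this weight decreases to `1`, so
      -- Dirichlet's test applies.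
      obtain ⟨D, hD, -⟩ := hM (fun x => 1 + ω ^ 2 * (x ^ 2 - ω ^ 2)⁻¹)
        (fun x => ω ^ 2 * (-(2 * x) / (x ^ 2 - ω ^ 2) ^ 2)) _
        (fun x hx => by
          have h1 : HasDerivAt (fun x : ℝ => x ^ 2 - ω ^ 2) (2 * x) x := by
            simpa using (hasDerivAt_pow 2 x).sub_const (ω ^ 2)
          exact ((h1.inv (hpos x hx).ne').const_mul _).const_add _)
        (ContinuousOn.mul (by fun_prop) (ContinuousOn.div (by fun_prop) (by fun_prop)
          fun x hx => pow_ne_zero _ (hpos x hx).ne'))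
        (fun x hx => by
          have hx0 : 0 < x := hR.trans_le hx
          rw [neg_div, mul_neg]
          exact neg_nonpos.2 (by positivity))
        (fun x hx => by
          have := hpos x hx
          positivity) hlim
      refine ⟨-D, hasTailIntegral_top (fun x hx => hcu x hx le_top) (hD.neg.congr' ?_)⟩
      filter_upwards [eventually_ge_atTop R] with A hA
      rw [← intervalIntegral.integral_neg]
      refine intervalIntegral.integral_congr fun x hx => ?_
      rw [Set.uIcc_of_le hA] at hx
      have hx0 : (x : ℂ) ≠ 0 := by exact_mod_cast (hR.trans_le hx.1).ne'
      have hne : (x : ℂ) ^ 2 - (ω : ℂ) ^ 2 ≠ 0 := by exact_mod_cast (hpos x hx.1).ne'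
      have hne' : (ω : ℂ) ^ 2 - (x : ℂ) ^ 2 ≠ 0 := by
        rw [← neg_sub]
        exact neg_ne_zero.2 hne
      push_cast
      rw [eq_div_iff hne']
      field_simp
      ring

/-! ### Gluing at `R`, and the final statements. -/

theorem analyticAt_of_lt_singularityDist {f : ℂ → ℂ} {z : ℂ}
    (hz : ENNReal.ofReal ‖z‖ < singularityDist f) : AnalyticAt ℂ f z := by
  by_contra h
  exact absurd (iInf₂_le z h) (not_le.2 hz)

/-- The expansion, without any assumption on the behaviour of `f` at the origin. -/
theorem exists_hasPV_hasSum {f : ℂ → ℂ} {a : WithTop ℝ} {ω : ℝ}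
    (hf : ComplexAnalyticOn f a) (hω : 0 < ω) (hωa : (ω : WithTop ℝ) < a)
    (hωρ : ENNReal.ofReal ω < singularityDist f)
    (htop : a = ⊤ →
      (∃ L : ℂ, HasPV (fun x : ℝ => (x : ℂ) * f x / ((ω : ℂ) ^ 2 - (x : ℂ) ^ 2)) ω ⊤ L) ∨
      (∃ L : ℂ, Tendsto (fun A : ℝ => ∫ x in (1 : ℝ)..A, f x / (x : ℂ)) atTop (𝓝 L))) :
    ∃ (I : ℂ) (F : ℕ → ℂ),
      HasPV (fun x : ℝ => (x : ℂ) * f x / ((ω : ℂ) ^ 2 - (x : ℂ) ^ 2)) ω a I ∧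
      (∀ k : ℕ, HasFinitePart (fun x : ℝ => f x / (x : ℂ) ^ (2 * k + 1)) a (F k)) ∧
      HasSum (fun k : ℕ => (ω : ℂ) ^ (2 * k) * F k)
        (1 / 2 * (f ω + f (-(ω : ℂ))) * (Real.log ω : ℂ) - I) := by
  obtain ⟨ρ, hρ0, hωρ', hρ⟩ := ENNReal.lt_iff_exists_real_btwn.1 hωρ
  have hωρ'' : ω < ρ := (ENNReal.ofReal_lt_ofReal_iff_of_nonneg hω.le).1 hωρ'
  obtain ⟨R, hωR, hRρ, hRa⟩ : ∃ R : ℝ, ω < R ∧ R < ρ ∧ (R : WithTop ℝ) < a := by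
    cases a with
    | coe A =>
      obtain ⟨R, h1, h2⟩ := exists_between (lt_min hωρ'' (WithTop.coe_lt_coe.1 hωa))
      exact ⟨R, h1, h2.trans_le (min_le_left _ _),
        WithTop.coe_lt_coe.2 (h2.trans_le (min_le_right _ _))⟩
    | top =>
      obtain ⟨R, h1, h2⟩ := exists_between hωρ''
      exact ⟨R, h1, h2, WithTop.coe_lt_top R⟩
  have hd : DifferentiableOn ℂ f (Metric.ball 0 ρ) := fun z hz => by
    rw [mem_ball_zero_iff] at hz
    exact (analyticAt_of_lt_singularityDist
      ((ENNReal.ofReal_le_ofReal hz.le).trans_lt hρ)).differentiableAt.differentiableWithinAt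
  obtain ⟨V, F, hV, hF, hs⟩ := exists_hasPVReal_hasSum hω hωR hRρ hd
  obtain ⟨U, hU⟩ := exists_hasTailIntegral hω hωR hRa hf hV htop
  obtain ⟨T, hT, hsT⟩ := hU.exists_hasSum hω hωR hRa hf
  refine ⟨V + U, fun k => F k + T k, HasPV.of_tail hRa hV hU,
    fun k => HasFinitePart.of_tail hRa (hF k) (hT k), ?_⟩
  refine ((hs.add hsT).congr_fun fun k => mul_add _ _ _).trans_eq ?_
  rw [← sub_eq_add_neg, sub_sub]

theorem HasFinitePart.congr {h h' : ℝ → ℂ} {a : WithTop ℝ} {v : ℂ}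
    (ha : ((0 : ℝ) : WithTop ℝ) < a) (hv : HasFinitePart h a v)
    (hh : ∀ x : ℝ, 0 < x → (x : WithTop ℝ) ≤ a → h x = h' x) : HasFinitePart h' a v :=
  UpTo.map continuous_id ha (fun _ _ hAa _ hA =>
    hA.congr fun x h0 h1 => hh x h0 ((WithTop.coe_le_coe.2 h1).trans hAa)) hv

end FinitePart

theorem theorem5p2 (f : ℂ → ℂ) (a : WithTop ℝ) (ω : ℝ)
    (hf : FinitePart.ComplexAnalyticOn f a)
    (hω0 : 0 < ω) (hωa : (ω : WithTop ℝ) < a)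
    (hωρ : ENNReal.ofReal ω < FinitePart.singularityDist f)
    -- for an infinite upper limit: the principal value exists in the limit, or `f x / x` is
    -- (possibly only conditionally) integrable at infinity
    (htop : a = ⊤ →
      (∃ L : ℂ, FinitePart.HasPV
        (fun x : ℝ => (x : ℂ) * f x / ((ω : ℂ) ^ 2 - (x : ℂ) ^ 2)) ω ⊤ L) ∨
      (∃ L : ℂ, Tendsto (fun A : ℝ => ∫ x in (1 : ℝ)..A, f x / (x : ℂ)) atTop (𝓝 L))) :
    -- `f 0 ≠ 0`, in general and for `f` even
    (f 0 ≠ 0 →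
      ∃ (I : ℂ) (F : ℕ → ℂ),
        FinitePart.HasPV
          (fun x : ℝ => (x : ℂ) * f x / ((ω : ℂ) ^ 2 - (x : ℂ) ^ 2)) ω a I ∧
        (∀ k : ℕ, FinitePart.HasFinitePart
          (fun x : ℝ => f x / (x : ℂ) ^ (2 * k + 1)) a (F k)) ∧
        Summable (fun k : ℕ => (ω : ℂ) ^ (2 * k) * F k) ∧
        I = - (∑' k : ℕ, (ω : ℂ) ^ (2 * k) * F k)
            + 1 / 2 * (f ω + f (-(ω : ℂ))) * (Real.log ω : ℂ) ∧
        (FinitePart.EvenWithin f (FinitePart.singularityDist f) →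
          I = - (∑' k : ℕ, (ω : ℂ) ^ (2 * k) * F k) + f ω * (Real.log ω : ℂ))) ∧
    -- a zero of order `m` at the origin
    (∀ (m : ℕ) (g : ℂ → ℂ), 1 ≤ m → AnalyticAt ℂ g 0 → g 0 ≠ 0 →
      (∀ z : ℂ, AnalyticAt ℂ f z → f z = z ^ m * g z) →
      (∃ (I : ℂ) (J F : ℕ → ℂ),
        FinitePart.HasPV
          (fun x : ℝ => (x : ℂ) * f x / ((ω : ℂ) ^ 2 - (x : ℂ) ^ 2)) ω a I ∧
        (∀ k ∈ Finset.range ((m - 1) / 2 + 1), FinitePart.HasIntegral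
          (fun x : ℝ => (x : ℂ) ^ (m - 2 * k - 1) * g x) a (J k)) ∧
        (∀ k : ℕ, FinitePart.HasFinitePart
          (fun x : ℝ => (x : ℂ) ^ m * g x / (x : ℂ) ^ (2 * k + 2 * ((m + 1) / 2) + 1))
          a (F k)) ∧
        Summable (fun k : ℕ => (ω : ℂ) ^ (2 * k + 2 * ((m + 1) / 2)) * F k) ∧
        I = - (∑ k ∈ Finset.range ((m - 1) / 2 + 1), (ω : ℂ) ^ (2 * k) * J k)
            - (∑' k : ℕ, (ω : ℂ) ^ (2 * k + 2 * ((m + 1) / 2)) * F k)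
            + (ω : ℂ) ^ m / 2 * (g ω + (-1) ^ m * g (-(ω : ℂ))) * (Real.log ω : ℂ)) ∧
      (FinitePart.EvenWithin g (FinitePart.singularityDist f) → Odd m →
        (ω : ℂ) ^ m / 2 * (g ω + (-1) ^ m * g (-(ω : ℂ))) * (Real.log ω : ℂ) = 0)) := by
  obtain ⟨I, F, hI, hF, hs⟩ := FinitePart.exists_hasPV_hasSum hf hω0 hωa hωρ htop
  have hIs : I = -(∑' k : ℕ, (ω : ℂ) ^ (2 * k) * F k)
      + 1 / 2 * (f ω + f (-(ω : ℂ))) * (Real.log ω : ℂ) := by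
    rw [hs.tsum_eq]
    ring
  refine ⟨fun _ => ⟨I, F, hI, hF, hs.summable, hIs, fun heven => ?_⟩,
    fun m g hm hg _ hfg => ⟨?_, fun heven hodd => ?_⟩⟩
  · rw [hIs, heven ω (by rwa [abs_of_pos hω0])]
    ring
  · have ha : ((0 : ℝ) : WithTop ℝ) < a := (WithTop.coe_lt_coe.2 hω0).trans hωa
    have hfx : ∀ x : ℝ, 0 ≤ x → (x : WithTop ℝ) ≤ a → f x = (x : ℂ) ^ m * g x :=
      fun x h0 h1 => hfg x (hf x h0 h1)
    have hgc : ∀ x : ℝ, 0 ≤ x → (x : WithTop ℝ) ≤ a → ContinuousAt (fun y : ℝ => g y) x := by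
      intro x h0 h1
      refine ContinuousAt.comp (f := fun y : ℝ => (y : ℂ)) ?_
        Complex.continuous_ofReal.continuousAt
      -- Away from `0`, `g` agrees with `f / z^m` near `x`, because `f` is analytic, hence factors,
      -- on a whole neighbourhood.
      rcases h0.eq_or_lt with rfl | h0'
      · exact_mod_cast hg.continuousAt
      · have hx : (x : ℂ) ≠ 0 := by exact_mod_cast h0'.ne'
        have hfa := hf x h0 h1
        refine (hfa.continuousAt.div (continuousAt_id.pow m) (pow_ne_zero m hx)).congr ?_
        filter_upwards [hfa.eventually_analyticAt, eventually_ne_nhds hx] with z hz hz0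
        rw [Pi.div_apply, hfg z hz]
        simp [hz0]
    have hM : (m + 1) / 2 = (m - 1) / 2 + 1 := by omega
    have hω1 : f ω = (ω : ℂ) ^ m * g ω := hfx ω hω0.le hωa.le
    have hω2 : f (-(ω : ℂ)) = (-(ω : ℂ)) ^ m * g (-(ω : ℂ)) :=
      hfg _ (FinitePart.analyticAt_of_lt_singularityDist (by
        rwa [norm_neg, Complex.norm_real, Real.norm_of_nonneg hω0.le]))
    -- It is the same series split at `k = (m + 1) / 2`: below that index `2k + 1 ≤ m`, so the zero
    -- of `f` absorbs the pole and the finite part is an ordinary integral.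
    refine ⟨I, F, fun k => F (k + (m + 1) / 2), hI, fun k hk => ?_, fun k => ?_, ?_, ?_⟩
    · have hk' : 2 * k + 1 ≤ m := by
        have := Finset.mem_range.1 hk
        omega
      refine (hF k).hasIntegral ha (fun A hA hAa => ?_) fun x h0 h1 => ?_
      · refine FinitePart.intervalIntegrable_of_continuousAt hA.le fun x h0 h1 => ?_
        have := hgc x h0 ((WithTop.coe_le_coe.2 h1).trans hAa)
        exact (Complex.continuous_ofReal.continuousAt.pow _).mul this
      · have hx : (x : ℂ) ≠ 0 := by exact_mod_cast h0.ne'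
        obtain ⟨d, rfl⟩ := Nat.exists_eq_add_of_le hk'
        rw [hfx x h0.le h1, show 2 * k + 1 + d - 2 * k - 1 = d by omega, pow_add]
        field_simp
    · refine (hF (k + (m + 1) / 2)).congr ha fun x h0 h1 => ?_
      rw [hfx x h0.le h1, mul_add]
    · refine ((summable_nat_add_iff ((m + 1) / 2)).2 hs.summable).congr fun k => ?_
      rw [mul_add]
    · have h1 := hs.summable.sum_add_tsum_nat_add ((m + 1) / 2)
      simp only [mul_add] at h1
      rw [hIs, ← h1, hM, hω1, hω2, neg_pow]
      ring
  · rw [heven ω (by rwa [abs_of_pos hω0]), hodd.neg_one_pow]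
    ring
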